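/- There is an absolute constant $C>0$ such that the following holds. Let $(\mathbb R^n,\langle\cdot,\cdot\rangle)$ be a Euclidean space with Euclidean norm $|\cdot|_2$ and unit ball $B_2^n$, and let $K\subset\mathbb R^n$ be a symmetric convex body (compact, convex, $K=-K$, with nonempty interior) of radius $D$, i.e. $D$ is the smallest number with $K\subset D B_2^n$. Let $\|\cdot\|_K$ be the norm with unit ball $K$, let $q\ge 2$, $\lambda>0$, and assume that $K$ has modulus of convexity of power type $q$ with constant $\lambda$, i.e. $$\Big\|\frac{x+y}{2}\Big\|_K^q+\lambda^{-q}\Big\|\frac{x-y}{2}\Big\|_K^q\le\frac12\big(\|x\|_K^q+\|y\|_K^q\big)\qquad\text{for all }x,y\in\mathbb R^n.$$ Let $q^*$ be the conjugate exponent of $q$, $1/q+1/q^*=1$. Then for every $p\ge q$, every $m\ge 2$, all deterministic vectors $X_1,\dots,X_m\in\mathbb R^n$, and independent symmetric Bernoulli ($\pm1$ valued) random variables $\varepsilon_1,\dots,\varepsilon_m$, the random variable $\sup_{y\in K}\big|\sum_{j=1}^m\varepsilon_j|\langle X_j,y\rangle|^p\big|$ is integrable and $$\mathbb E\sup_{y\in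 K}\Big|\sum_{j=1}^m\varepsilon_j|\langle X_j,y\rangle|^p\Big|\le C^p\,\lambda^p\,(\log m)^{1/q^*}\,D\,\max_{1\le j\le m}|X_j|_2\,\sup_{y\in K}\Big(\sum_{j=1}^m|\langle X_j,y\rangle|^{2(p-1)}\Big)^{1/2}.$$ -/

import Mathlib

open MeasureTheory ProbabilityTheory

/-- The radius of `K` is `D`: the smallest `D` such that `K` is contained in `D` times the
Euclidean unit ball. -/
def HasRadius {E : Type*} [NormedAddCommGroup E] (K : Set E) (D : ℝ) : Prop :=
  IsLeast {R : ℝ | K ⊆ Metric.closedBall 0 R} D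

/-- `K` has modulus of convexity of power type `q` with constant `lam`. For a symmetric convex
body `K`, the norm with unit ball `K` is `gauge K`. -/
def HasConvexityPowerType {E : Type*} [AddCommGroup E] [Module ℝ E]
    (K : Set E) (q lam : ℝ) : Prop :=
  ∀ x y : E,
    gauge K ((2 : ℝ)⁻¹ • (x + y)) ^ q + lam ^ (-q) * gauge K ((2 : ℝ)⁻¹ • (x - y)) ^ q
      ≤ (gauge K x ^ q + gauge K y ^ q) / 2

/-- `ε` is a family of independent symmetric Bernoulli (`±1` valued) random variables on the
probability space `(Ω, μ)`. -/
structure IsBernoulliSigns {ι Ω : Type*} [MeasurableSpace Ω] (μ : Measure Ω)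
    (ε : ι → Ω → ℝ) : Prop where
  measurable : ∀ j, Measurable (ε j)
  indep : iIndepFun ε μ
  prob_one : ∀ j, μ {ω | ε j ω = 1} = 1 / 2
  prob_neg_one : ∀ j, μ {ω | ε j ω = -1} = 1 / 2

/-!
The process `y ↦ ∑ j, ε j |⟪X j, y⟫| ^ p` is subgaussian for the distance
`d(x, y) = ‖F x - F y‖₂`, where `F x` has coordinates `sign ⟪X j, x⟫ |⟪X j, x⟫| ^ p` (`powerMap`);
the signs make each coordinate monotone, so that the midpoint of `x` and `y` is `d`-closer to `x`
than `y` is. The bound follows by chaining along nested partitions of `K`, which are built from an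
interpolation functional in place of a majorizing measure.

Write `A = D * max ‖X j‖ * sup_y (∑ j, |⟪X j, y⟫| ^ (2 (p - 1))) ^ (1 / 2)`. Three facts carry the
argument.

* Entropy (`exists_label_of_gauge_le`). Near a point `u ∈ K` the distance `d` is dominated by the
  Hilbert norm with weights `|⟪X j, u⟫| ^ (p - 1)` plus a multiple of `max_j |⟪X j, ·⟫|`. By the
  dual Sudakov inequality, obtained from translates of a symmetric set under the Gaussian measure,
  a part of `K` of `K`-radius `R` splits into `2 ^ 2 ^ (n + 1)` pieces of `d`-diameter at most
  `16 ^ p * A * 2 ^ (-n / 2) * (R + √(3 log m) * R ^ p)`: the term linear in `R` is free of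
  logarithms.
* Convexity (`gauge_sub_rpow_le`). Let `π n x` minimize `‖y‖_K ^ q + c * 2 ^ (n / 2) * d(x, y)` over
  `y ∈ K`. Comparing minimizers with their midpoint, uniform convexity gives
  `‖y₁ - y₂‖_K ^ q ≤ (2 λ) ^ q * c * 2 ^ (n / 2) * d(y₁, y₂)` for any two of them, so that
  minimizers at distance `δ` have `K`-distance at most `R = 2 λ (c * 2 ^ (n / 2) * δ) ^ (1 / q)`.
  Moreover `∑ n, 2 ^ (n / 2) * d(x, π n x) ≤ 4 / c` by monotonicity of the minima
  (`sum_dist_isInterpolant_le`).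
* Contraction (`exists_label_diam_le`). With this `R`, Young's inequality and `p ≥ q` bound the
  entropy of the minimizers by a small multiple of `δ` plus `2 ^ (-n / 2) / (N c)`, provided that
  `1 / c` is of order `C ^ p * λ ^ p * A * (log m) ^ (1 / q')` and the number of levels `N` is at
  most `3 log m` (`radius_add_le_of_young`). Refining a cell then reduces its diameter by a fixed
  factor, up to summable errors, and `∑ n ≤ N, 2 ^ (n / 2) * diam (cell n x) ≤ 96 / c`
  (`exists_partitions`).

Chaining stops at the level `N` with `2 ^ N ≥ m`, where the Cauchy–Schwarz inequality
`|∑ j, ε j a j| ≤ √m * ‖a‖₂` takes over (`exists_dominating`). This is why only `log m` levels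
contribute, and Hölder's inequality over these levels, hidden in the choice of `c`, produces the
exponent `1 / q'`.
-/

/-! ### Signed powers -/

/-- The odd extension `t ↦ sign(t) |t| ^ p` of the power function. -/
noncomputable def signedPow (p t : ℝ) : ℝ := t * |t| ^ (p - 1)

lemma signedPow_of_nonneg {p t : ℝ} (hp : 1 < p) (ht : 0 ≤ t) : signedPow p t = t ^ p := by
  rw [signedPow, abs_of_nonneg ht]
  rcases ht.eq_or_lt with rfl | h
  · rw [zero_mul, Real.zero_rpow (by linarith)]
  · rw [Real.rpow_sub_one h.ne']
    field_simp

lemma signedPow_neg (p t : ℝ) : signedPow p (-t) = -signedPow p t := by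
  simp [signedPow]

lemma continuous_signedPow {p : ℝ} (hp : 1 < p) : Continuous (signedPow p) := by
  unfold signedPow
  exact continuous_id.mul (continuous_abs.rpow_const fun _ => Or.inr (by linarith))

lemma abs_signedPow {p : ℝ} (hp : 1 < p) (t : ℝ) : |signedPow p t| = |t| ^ p := by
  rw [← signedPow_of_nonneg hp (abs_nonneg t), signedPow, signedPow, abs_mul, abs_abs,
    abs_of_nonneg (Real.rpow_nonneg (abs_nonneg t) _)]

lemma monotone_signedPow {p : ℝ} (hp : 1 < p) : Monotone (signedPow p) := by
  have hnn : ∀ {a b : ℝ}, 0 ≤ a → a ≤ b → signedPow p a ≤ signedPow p b := fun ha hab => by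
    rw [signedPow_of_nonneg hp ha, signedPow_of_nonneg hp (ha.trans hab)]
    exact Real.rpow_le_rpow ha hab (by linarith)
  intro a b hab
  rcases le_total 0 a with ha | ha
  · exact hnn ha hab
  rcases le_total 0 b with hb | hb
  · exact (mul_nonpos_of_nonpos_of_nonneg ha (Real.rpow_nonneg (abs_nonneg a) _)).trans
      (mul_nonneg hb (Real.rpow_nonneg (abs_nonneg b) _))
  · have := hnn (neg_nonneg.2 hb) (neg_le_neg hab)
    rwa [signedPow_neg, signedPow_neg, neg_le_neg_iff] at this

lemma abs_abs_rpow_sub_le {p : ℝ} (hp : 1 < p) (a b : ℝ) :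
    |(|a| ^ p - |b| ^ p)| ≤ |signedPow p a - signedPow p b| := by
  rw [← abs_signedPow hp, ← abs_signedPow hp]
  exact abs_abs_sub_abs_le _ _

/-- By monotonicity the image of a midpoint lies between the images of the end points. -/
lemma abs_signedPow_sub_midpoint_le {p : ℝ} (hp : 1 < p) (a b : ℝ) :
    |signedPow p a - signedPow p (2⁻¹ * (a + b))| ≤ |signedPow p a - signedPow p b| := by
  rcases le_total a b with h | h
  · have h1 := monotone_signedPow hp (show a ≤ 2⁻¹ * (a + b) by linarith)
    have h2 := monotone_signedPow hp (show 2⁻¹ * (a + b) ≤ b by linarith)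
    rw [abs_of_nonpos (by linarith), abs_of_nonpos (by linarith)]
    linarith
  · have h1 := monotone_signedPow hp (show 2⁻¹ * (a + b) ≤ a by linarith)
    have h2 := monotone_signedPow hp (show b ≤ 2⁻¹ * (a + b) by linarith)
    rw [abs_of_nonneg (by linarith), abs_of_nonneg (by linarith)]
    linarith

lemma rpow_sub_rpow_le {p a b : ℝ} (hp : 1 < p) (hb : 0 ≤ b) (hab : b ≤ a) :
    a ^ p - b ^ p ≤ p * (a - b) * a ^ (p - 1) := by
  rcases hab.eq_or_lt with rfl | h
  · simp
  have ha : 0 < a := hb.trans_lt h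
  -- Bernoulli's inequality at `b / a - 1 ≥ -1`
  have hB := one_add_mul_self_le_rpow_one_add (s := b / a - 1)
    (by linarith [div_nonneg hb ha.le]) hp.le
  rw [add_sub_cancel, Real.div_rpow hb ha.le] at hB
  have hap : 0 < a ^ p := Real.rpow_pos_of_pos ha p
  have h1 : (1 + p * (b / a - 1)) * a ^ p ≤ b ^ p := by
    rwa [le_div_iff₀ hap] at hB
  rw [Real.rpow_sub_one ha.ne']
  have h2 : (1 + p * (b / a - 1)) * a ^ p = a ^ p - p * (a - b) * (a ^ p / a) := by
    field_simp
    ring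
  linarith

lemma abs_signedPow_sub_le {p : ℝ} (hp : 1 < p) (a b : ℝ) :
    |signedPow p a - signedPow p b| ≤ p * |a - b| * max |a| |b| ^ (p - 1) := by
  have hnn : ∀ {a b : ℝ}, 0 ≤ b → b ≤ a →
      signedPow p a - signedPow p b ≤ p * (a - b) * max |a| |b| ^ (p - 1) := fun {a b} hb hab => by
    rw [signedPow_of_nonneg hp hb, signedPow_of_nonneg hp (hb.trans hab), abs_of_nonneg hb,
      abs_of_nonneg (hb.trans hab), max_eq_left hab]
    exact rpow_sub_rpow_le hp hb hab
  have hle : ∀ {a b : ℝ}, b ≤ a →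
      signedPow p a - signedPow p b ≤ p * (a - b) * max |a| |b| ^ (p - 1) := fun {a b} hab => by
    rcases le_total 0 b with hb | hb
    · exact hnn hb hab
    rcases le_total a 0 with ha | ha
    · have := hnn (neg_nonneg.2 ha) (neg_le_neg hab)
      rw [signedPow_neg, signedPow_neg, abs_neg, abs_neg, max_comm] at this
      linarith
    · have hX : 0 ≤ max |a| |b| ^ (p - 1) := by positivity
      have h1 : |a| ^ (p - 1) ≤ max |a| |b| ^ (p - 1) :=
        Real.rpow_le_rpow (abs_nonneg _) (le_max_left _ _) (by linarith)
      have h2 : |b| ^ (p - 1) ≤ max |a| |b| ^ (p - 1) :=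
        Real.rpow_le_rpow (abs_nonneg _) (le_max_right _ _) (by linarith)
      have h3 : 0 ≤ (a - b) * max |a| |b| ^ (p - 1) := mul_nonneg (by linarith) hX
      unfold signedPow
      nlinarith [mul_le_mul_of_nonneg_left h1 ha, mul_le_mul_of_nonneg_left h2 (neg_nonneg.2 hb)]
  rcases le_total b a with h | h
  · rw [abs_of_nonneg (sub_nonneg.2 (monotone_signedPow hp h)), abs_of_nonneg (sub_nonneg.2 h)]
    exact hle h
  · rw [abs_sub_comm, abs_sub_comm a b, max_comm,
      abs_of_nonneg (sub_nonneg.2 (monotone_signedPow hp h)), abs_of_nonneg (sub_nonneg.2 h)]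
    exact hle h

/-! ### Gaussian measure of translates -/

section Gaussian

variable {E : Type*} [NormedAddCommGroup E] [InnerProductSpace ℝ E] [FiniteDimensional ℝ E]
  [MeasurableSpace E] [BorelSpace E]

lemma integrable_exp_neg_half_sq_norm :
    Integrable (fun z : E => Real.exp (-‖z‖ ^ 2 / 2)) := by
  have h := (GaussianFourier.integrable_cexp_neg_mul_sq_norm_add (V := E) (b := 1 / 2)
    (by norm_num) 0 0).norm
  refine h.congr (Filter.Eventually.of_forall fun z => ?_)
  simp only [Complex.norm_exp]
  congr 1
  have : (-(1 / 2 : ℂ) * (‖z‖ : ℂ) ^ 2 + 0 * ((inner ℝ 0 z : ℝ) : ℂ)) = ((-‖z‖ ^ 2 / 2 : ℝ) : ℂ) := by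
    push_cast; ring
  rw [this, Complex.ofReal_re]

lemma integral_exp_neg_half_sq_norm_pos :
    0 < ∫ z : E, Real.exp (-‖z‖ ^ 2 / 2) := by
  exact integral_exp_pos integrable_exp_neg_half_sq_norm

lemma exp_inner_mul_gaussian {E : Type*} [NormedAddCommGroup E] [InnerProductSpace ℝ E]
    (w z : E) :
    Real.exp (inner ℝ w z) * Real.exp (-‖z‖ ^ 2 / 2)
      = Real.exp (‖w‖ ^ 2 / 2) * Real.exp (-‖z - w‖ ^ 2 / 2) := by
  rw [← Real.exp_add, ← Real.exp_add, norm_sub_sq_real, real_inner_comm]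
  congr 1; ring

lemma integrable_exp_inner_mul_gaussian (w : E) :
    Integrable (fun z : E => Real.exp (inner ℝ w z) * Real.exp (-‖z‖ ^ 2 / 2)) := by
  simp_rw [exp_inner_mul_gaussian]
  exact (integrable_exp_neg_half_sq_norm.comp_sub_right w).const_mul _

lemma integral_exp_inner_mul_gaussian (w : E) :
    ∫ z : E, Real.exp (inner ℝ w z) * Real.exp (-‖z‖ ^ 2 / 2)
      = Real.exp (‖w‖ ^ 2 / 2) * ∫ z : E, Real.exp (-‖z‖ ^ 2 / 2) := by
  simp_rw [exp_inner_mul_gaussian]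
  rw [integral_const_mul, integral_sub_right_eq_self (fun z : E => Real.exp (-‖z‖ ^ 2 / 2)) w]

/-- Shifting a symmetric set by `y` decreases its Gaussian mass at most by the factor
`exp (-‖y‖² / 2)`. The Gaussian density is not normalized here. -/
lemma le_integral_translate_of_symmetric {B : Set E} (hBm : MeasurableSet B)
    (hBs : ∀ x ∈ B, -x ∈ B) (y : E) :
    Real.exp (-‖y‖ ^ 2 / 2) * ∫ z, B.indicator 1 z * Real.exp (-‖z‖ ^ 2 / 2)
      ≤ ∫ z, B.indicator 1 (z - y) * Real.exp (-‖z‖ ^ 2 / 2) := by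
  have hint : ∀ w : E, Integrable fun z : E => B.indicator 1 z * Real.exp (-‖z + w‖ ^ 2 / 2) := by
    intro w
    refine ((integrable_exp_neg_half_sq_norm (E := E)).comp_add_right w).bdd_mul
      (c := 1) ((measurable_one.indicator hBm).aestronglyMeasurable)
      (Filter.Eventually.of_forall fun z => ?_)
    by_cases hz : z ∈ B <;> simp [hz]
  have h1 : ∫ z, B.indicator 1 (z - y) * Real.exp (-‖z‖ ^ 2 / 2)
      = ∫ z, B.indicator 1 z * Real.exp (-‖z + y‖ ^ 2 / 2) := by
    rw [← integral_add_right_eq_self _ y]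
    simp
  have hind : ∀ z : E, B.indicator (1 : E → ℝ) (-z) = B.indicator 1 z := fun z => by
    by_cases hz : z ∈ B
    · simp [hz, hBs z hz]
    · have : -z ∉ B := fun h => hz (by simpa using hBs _ h)
      simp [hz, this]
  have h2 : ∫ z, B.indicator 1 z * Real.exp (-‖z + y‖ ^ 2 / 2)
      = ∫ z, B.indicator 1 z * Real.exp (-‖z + -y‖ ^ 2 / 2) := by
    rw [← integral_neg_eq_self]
    refine integral_congr_ae (Filter.Eventually.of_forall fun z => ?_)
    simp only [hind]
    rw [← norm_neg (-z + y)]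
    congr 4
    abel_nf
  rw [h1]
  have h3 : ∫ z, B.indicator 1 z * Real.exp (-‖z + y‖ ^ 2 / 2)
      = ∫ z, (B.indicator 1 z * Real.exp (-‖z + y‖ ^ 2 / 2)
        + B.indicator 1 z * Real.exp (-‖z + -y‖ ^ 2 / 2)) / 2 := by
    rw [integral_div, integral_add (hint y) (hint (-y)), ← h2]
    ring
  rw [h3, ← integral_const_mul]
  refine integral_mono ?_ (((hint y).add (hint (-y))).div_const 2) fun z => ?_
  · simpa using (hint 0).const_mul (Real.exp (-‖y‖ ^ 2 / 2))
  have hnn : 0 ≤ B.indicator (1 : E → ℝ) z := Set.indicator_nonneg (fun _ _ => zero_le_one) _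
  -- the arithmetic mean of the two translated densities dominates their geometric mean
  have key : Real.exp (-‖y‖ ^ 2 / 2) * Real.exp (-‖z‖ ^ 2 / 2)
      ≤ (Real.exp (-‖z + y‖ ^ 2 / 2) + Real.exp (-‖z + -y‖ ^ 2 / 2)) / 2 := by
    have hpar : -‖y‖ ^ 2 / 2 + -‖z‖ ^ 2 / 2 = (-‖z + y‖ ^ 2 / 2) / 2 + (-‖z + -y‖ ^ 2 / 2) / 2 := by
      have := parallelogram_law_with_norm ℝ z y
      rw [← sub_eq_add_neg]
      nlinarith
    rw [← Real.exp_add, hpar, Real.exp_add]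
    set a := -‖z + y‖ ^ 2 / 2
    set b := -‖z + -y‖ ^ 2 / 2
    have ha : Real.exp a = Real.exp (a / 2) ^ 2 := by rw [← Real.exp_nat_mul]; congr 1; push_cast; ring
    have hb : Real.exp b = Real.exp (b / 2) ^ 2 := by rw [← Real.exp_nat_mul]; congr 1; push_cast; ring
    nlinarith [sq_nonneg (Real.exp (a / 2) - Real.exp (b / 2))]
  have := mul_le_mul_of_nonneg_left key hnn
  simp only
  nlinarith

/-- Volumetric form of the dual Sudakov inequality: disjoint translates of a symmetric set of
Gaussian measure at least `1 / 2`, with centres in a ball of radius `ϱ`, number at most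
`2 * exp (ϱ ^ 2 / 2)`. -/
lemma card_le_of_disjoint_translates {B : Set E} (hBm : MeasurableSet B)
    (hBs : ∀ x ∈ B, -x ∈ B)
    (hB : (∫ z : E, Real.exp (-‖z‖ ^ 2 / 2)) / 2
      ≤ ∫ z, B.indicator 1 z * Real.exp (-‖z‖ ^ 2 / 2))
    (P : Finset E) {ϱ : ℝ} (hP : ∀ y ∈ P, ‖y‖ ≤ ϱ)
    (hd : ∀ y ∈ P, ∀ y' ∈ P, y ≠ y' → ∀ z, z - y ∈ B → z - y' ∉ B) :
    (P.card : ℝ) ≤ 2 * Real.exp (ϱ ^ 2 / 2) := by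
  set I := ∫ z : E, Real.exp (-‖z‖ ^ 2 / 2) with hI
  have hIpos : 0 < I := integral_exp_neg_half_sq_norm_pos
  have hint : ∀ y : E, Integrable fun z : E => B.indicator 1 (z - y) * Real.exp (-‖z‖ ^ 2 / 2) := by
    intro y
    refine (integrable_exp_neg_half_sq_norm (E := E)).bdd_mul
      (c := 1) (((measurable_one.indicator hBm).comp (measurable_sub_const y)).aestronglyMeasurable)
      (Filter.Eventually.of_forall fun z => ?_)
    by_cases hz : z - y ∈ B <;> simp [hz]
  have hsum : ∑ y ∈ P, ∫ z, B.indicator 1 (z - y) * Real.exp (-‖z‖ ^ 2 / 2) ≤ I := by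
    rw [← integral_finsetSum _ fun y _ => hint y]
    refine integral_mono (integrable_finsetSum _ fun y _ => hint y)
      integrable_exp_neg_half_sq_norm fun z => ?_
    simp only
    rw [← Finset.sum_mul]
    refine mul_le_of_le_one_left (Real.exp_pos _).le ?_
    by_cases h : ∃ y ∈ P, z - y ∈ B
    · obtain ⟨y, hy, hyz⟩ := h
      rw [Finset.sum_eq_single_of_mem y hy fun y' hy' hne =>
        Set.indicator_of_notMem (hd y hy y' hy' hne.symm z hyz) _]
      simp [hyz]
    · push Not at h
      rw [Finset.sum_eq_zero fun y hy => Set.indicator_of_notMem (h y hy) _]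
      exact zero_le_one
  have hlow : ∀ y ∈ P, Real.exp (-ϱ ^ 2 / 2) * (I / 2)
      ≤ ∫ z, B.indicator 1 (z - y) * Real.exp (-‖z‖ ^ 2 / 2) := fun y hy => by
    refine le_trans ?_ (le_integral_translate_of_symmetric hBm hBs y)
    refine mul_le_mul ?_ hB (by positivity) (Real.exp_pos _).le
    refine Real.exp_le_exp.2 ?_
    have := pow_le_pow_left₀ (norm_nonneg y) (hP y hy) 2
    linarith
  have h1 := (Finset.card_nsmul_le_sum P _ _ hlow).trans hsum
  rw [nsmul_eq_mul] at h1
  have h2 : (P.card : ℝ) * Real.exp (-ϱ ^ 2 / 2) ≤ 2 := by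
    by_contra! h
    nlinarith
  have h3 : Real.exp (-ϱ ^ 2 / 2) = (Real.exp (ϱ ^ 2 / 2))⁻¹ := by
    rw [← Real.exp_neg]; congr 1; ring
  rwa [h3, ← div_eq_mul_inv, div_le_iff₀ (Real.exp_pos _)] at h2

end Gaussian

/-! ### Exponential moments and packing for the Gaussian density -/

lemma sq_le_exp_add_exp_neg (s : ℝ) : s ^ 2 ≤ Real.exp s + Real.exp (-s) := by
  have key : ∀ t : ℝ, 0 ≤ t → t ^ 2 ≤ Real.exp t := fun t ht => by
    have h1 := Real.quadratic_le_exp_of_nonneg (by positivity : 0 ≤ t / 2)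
    have h2 : Real.exp t = Real.exp (t / 2) ^ 2 := by
      rw [← Real.exp_nat_mul]; congr 1; push_cast; ring
    have h3 := pow_le_pow_left₀ (by positivity) h1 2
    nlinarith [mul_nonneg ht (sq_nonneg (t - 2)), pow_nonneg ht 4]
  rcases le_total 0 s with h | h
  · linarith [key s h, Real.exp_pos (-s)]
  · have := key (-s) (neg_nonneg.2 h)
    rw [neg_sq] at this
    linarith [Real.exp_pos s]

section Gaussian

variable {E : Type*} [NormedAddCommGroup E] [InnerProductSpace ℝ E] [FiniteDimensional ℝ E]
  [MeasurableSpace E] [BorelSpace E]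

lemma integral_exp_add_exp_neg_mul_gaussian_le {w : E} {r : ℝ} (hw : ‖w‖ ≤ r) :
    ∫ z : E, (Real.exp (inner ℝ w z) + Real.exp (-inner ℝ w z)) * Real.exp (-‖z‖ ^ 2 / 2)
      ≤ 2 * Real.exp (r ^ 2 / 2) * ∫ z : E, Real.exp (-‖z‖ ^ 2 / 2) := by
  have h := integral_add (integrable_exp_inner_mul_gaussian w)
    (integrable_exp_inner_mul_gaussian (-w))
  simp only [inner_neg_left, ← add_mul] at h
  rw [h, integral_exp_inner_mul_gaussian]
  have h2 := integral_exp_inner_mul_gaussian (-w)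
  simp only [inner_neg_left, norm_neg] at h2
  rw [h2, ← two_mul, ← mul_assoc]
  refine mul_le_mul_of_nonneg_right ?_ integral_exp_neg_half_sq_norm_pos.le
  have := pow_le_pow_left₀ (norm_nonneg w) hw 2
  have := Real.exp_le_exp.2 (show ‖w‖ ^ 2 / 2 ≤ r ^ 2 / 2 by linarith)
  linarith

lemma integrable_exp_add_exp_neg_mul_gaussian (w : E) :
    Integrable fun z : E =>
      (Real.exp (inner ℝ w z) + Real.exp (-inner ℝ w z)) * Real.exp (-‖z‖ ^ 2 / 2) := by
  have h := (integrable_exp_inner_mul_gaussian w).add (integrable_exp_inner_mul_gaussian (-w))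
  refine h.congr (Filter.Eventually.of_forall fun z => ?_)
  simp [add_mul]

/-- A weighted Euclidean norm and a maximum of linear functionals are simultaneously controlled
on a set of Gaussian measure at least `1 / 2`. -/
lemma half_le_gaussian_mass {m : ℕ} {X : Fin m → E} {w : Fin m → ℝ} {H M τ : ℝ} (hH : 0 < H)
    (hX : ∀ j, ‖X j‖ ≤ H) (hM : 0 < M) (hw : ∑ j, w j ^ 2 ≤ M ^ 2) (hτ : 0 < τ)
    (hm : 8 * (m : ℝ) ≤ Real.exp (τ ^ 2 / 2)) :
    (∫ z : E, Real.exp (-‖z‖ ^ 2 / 2)) / 2 ≤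
      ∫ z : E, {z : E | ∑ j, w j ^ 2 * inner ℝ (X j) z ^ 2 ≤ 16 * (H * M) ^ 2 ∧
        ∀ j, |inner ℝ (X j) z| ≤ τ * H}.indicator 1 z * Real.exp (-‖z‖ ^ 2 / 2) := by
  set B := {z : E | ∑ j, w j ^ 2 * inner ℝ (X j) z ^ 2 ≤ 16 * (H * M) ^ 2 ∧
        ∀ j, |inner ℝ (X j) z| ≤ τ * H} with hBdef
  set I := ∫ z : E, Real.exp (-‖z‖ ^ 2 / 2) with hI
  have hIpos : 0 < I := integral_exp_neg_half_sq_norm_pos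
  have hBm : MeasurableSet B := by
    refine IsClosed.measurableSet ?_
    rw [hBdef, Set.ofPred_and, Set.ofPred_forall]
    exact (isClosed_le (by fun_prop) continuous_const).inter
      (isClosed_iInter fun j => isClosed_le (by fun_prop) continuous_const)
  set e : E → E → ℝ := fun v z =>
    (Real.exp (inner ℝ v z) + Real.exp (-inner ℝ v z)) * Real.exp (-‖z‖ ^ 2 / 2) with he
  have hei : ∀ v, Integrable (e v) := integrable_exp_add_exp_neg_mul_gaussian
  have hBi : Integrable fun z : E => B.indicator 1 z * Real.exp (-‖z‖ ^ 2 / 2) := by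
    refine (integrable_exp_neg_half_sq_norm (E := E)).bdd_mul
      (c := 1) (measurable_one.indicator hBm).aestronglyMeasurable
      (Filter.Eventually.of_forall fun z => ?_)
    by_cases hz : z ∈ B <;> simp [hz]
  have hs1 : Integrable fun z => ∑ j, w j ^ 2 / (16 * M ^ 2) * e (H⁻¹ • X j) z :=
    integrable_finsetSum _ fun j _ => (hei _).const_mul _
  have hs2 : Integrable fun z => ∑ j, Real.exp (-τ ^ 2) * e ((τ / H) • X j) z :=
    integrable_finsetSum _ fun j _ => (hei _).const_mul _
  -- outside `B` one of the two exponential sums exceeds `1`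
  have hpt : ∀ z, Real.exp (-‖z‖ ^ 2 / 2) ≤ B.indicator 1 z * Real.exp (-‖z‖ ^ 2 / 2)
      + (∑ j, w j ^ 2 / (16 * M ^ 2) * e (H⁻¹ • X j) z
        + ∑ j, Real.exp (-τ ^ 2) * e ((τ / H) • X j) z) := by
    intro z
    have hφ := Real.exp_pos (-‖z‖ ^ 2 / 2)
    have hn1 : 0 ≤ ∑ j, w j ^ 2 / (16 * M ^ 2) * e (H⁻¹ • X j) z :=
      Finset.sum_nonneg fun j _ => by positivity
    have hn2 : 0 ≤ ∑ j, Real.exp (-τ ^ 2) * e ((τ / H) • X j) z :=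
      Finset.sum_nonneg fun j _ => by positivity
    by_cases hz : z ∈ B
    · simp only [hz, Set.indicator_of_mem, Pi.one_apply, one_mul]
      linarith
    · rw [Set.indicator_of_notMem hz, zero_mul, zero_add]
      have hz' : 16 * (H * M) ^ 2 < ∑ j, w j ^ 2 * inner ℝ (X j) z ^ 2 ∨
          ∃ j, τ * H < |inner ℝ (X j) z| := by
        by_contra! h
        exact hz h
      rcases hz' with h | ⟨j, hj⟩
      · refine le_trans ?_ (le_add_of_nonneg_right hn2)
        have : ∑ j, w j ^ 2 / (16 * M ^ 2) * ((inner ℝ (X j) z / H) ^ 2)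
            ≤ ∑ j, w j ^ 2 / (16 * M ^ 2) * (Real.exp (inner ℝ (H⁻¹ • X j) z)
              + Real.exp (-inner ℝ (H⁻¹ • X j) z)) := by
          refine Finset.sum_le_sum fun j _ => mul_le_mul_of_nonneg_left ?_ (by positivity)
          rw [real_inner_smul_left, div_eq_inv_mul]
          exact sq_le_exp_add_exp_neg _
        have h1 : ∑ j, w j ^ 2 / (16 * M ^ 2) * ((inner ℝ (X j) z / H) ^ 2)
            = (∑ j, w j ^ 2 * inner ℝ (X j) z ^ 2) / (16 * (H * M) ^ 2) := by
          rw [Finset.sum_div]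
          refine Finset.sum_congr rfl fun j _ => ?_
          field_simp
        have h2 : 1 < (∑ j, w j ^ 2 * inner ℝ (X j) z ^ 2) / (16 * (H * M) ^ 2) := by
          rwa [one_lt_div (by positivity)]
        simp only [he, ← mul_assoc]
        rw [← Finset.sum_mul]
        exact le_mul_of_one_le_left hφ.le (by linarith)
      · refine le_trans ?_ (le_add_of_nonneg_left hn1)
        refine le_trans ?_ (Finset.single_le_sum (f := fun j =>
          Real.exp (-τ ^ 2) * e ((τ / H) • X j) z) (fun j _ => by positivity)
          (Finset.mem_univ j))
        simp only [he, ← mul_assoc]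
        refine le_mul_of_one_le_left hφ.le ?_
        rw [real_inner_smul_left]
        have h1 : τ ^ 2 ≤ |τ / H * inner ℝ (X j) z| := by
          rw [abs_mul, abs_of_pos (by positivity : 0 < τ / H), div_mul_eq_mul_div,
            le_div_iff₀ hH]
          nlinarith
        have h2 : Real.exp (τ ^ 2) ≤ Real.exp (τ / H * inner ℝ (X j) z)
            + Real.exp (-(τ / H * inner ℝ (X j) z)) := by
          have p1 := Real.exp_pos (τ / H * inner ℝ (X j) z)
          have p2 := Real.exp_pos (-(τ / H * inner ℝ (X j) z))
          rcases abs_choice (τ / H * inner ℝ (X j) z) with h | h <;> rw [h] at h1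
          · linarith [Real.exp_le_exp.2 h1]
          · linarith [Real.exp_le_exp.2 h1]
        calc (1 : ℝ) = Real.exp (-τ ^ 2) * Real.exp (τ ^ 2) := by
              rw [← Real.exp_add]; simp
          _ ≤ _ := mul_le_mul_of_nonneg_left h2 (Real.exp_pos _).le
  have hint := integral_mono integrable_exp_neg_half_sq_norm (hBi.add (hs1.add hs2)) hpt
  have hsplit := integral_add hBi (hs1.add hs2)
  have hsplit' := integral_add hs1 hs2
  simp only [Pi.add_apply] at hint hsplit hsplit'
  rw [hsplit, hsplit', integral_finsetSum _ fun j _ => (hei _).const_mul _,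
    integral_finsetSum _ fun j _ => (hei _).const_mul _] at hint
  simp only [integral_const_mul] at hint
  have hb1 : ∑ j, w j ^ 2 / (16 * M ^ 2) * ∫ z, e (H⁻¹ • X j) z ≤ I / 4 := by
    have hexp : Real.exp (1 ^ 2 / 2) ≤ 2 := by
      have h := Real.exp_one_lt_d9
      have h' : Real.exp (1 ^ 2 / 2) ^ 2 = Real.exp 1 := by
        rw [← Real.exp_nat_mul]; norm_num
      nlinarith [Real.exp_pos (1 ^ 2 / 2)]
    calc _ ≤ ∑ j, w j ^ 2 / (16 * M ^ 2) * (4 * I) := by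
          refine Finset.sum_le_sum fun j _ => mul_le_mul_of_nonneg_left ?_ (by positivity)
          refine (integral_exp_add_exp_neg_mul_gaussian_le (r := 1) ?_).trans ?_
          · rw [norm_smul, norm_inv, Real.norm_of_nonneg hH.le, inv_mul_le_iff₀ hH, mul_one]
            exact hX j
          · exact mul_le_mul_of_nonneg_right (by linarith) hIpos.le
      _ = (∑ j, w j ^ 2) / M ^ 2 * (I / 4) := by
          rw [← Finset.sum_mul, ← Finset.sum_div]
          field_simp
          ring
      _ ≤ I / 4 := mul_le_of_le_one_left (by positivity) (div_le_one_of_le₀ hw (by positivity))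
  have hb2 : ∑ j, Real.exp (-τ ^ 2) * ∫ z, e ((τ / H) • X j) z ≤ I / 4 := by
    calc _ ≤ ∑ _j : Fin m, Real.exp (-τ ^ 2) * (2 * Real.exp (τ ^ 2 / 2) * I) := by
          refine Finset.sum_le_sum fun j _ => mul_le_mul_of_nonneg_left ?_ (Real.exp_pos _).le
          refine integral_exp_add_exp_neg_mul_gaussian_le ?_
          rw [norm_smul, norm_div, Real.norm_of_nonneg hH.le, Real.norm_of_nonneg hτ.le,
            div_mul_eq_mul_div, div_le_iff₀ hH]
          exact mul_le_mul_of_nonneg_left (hX j) hτ.le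
      _ = 8 * m * (Real.exp (-τ ^ 2) * Real.exp (τ ^ 2 / 2)) * (I / 4) := by
          rw [Finset.sum_const, Finset.card_univ, Fintype.card_fin, nsmul_eq_mul]
          ring
      _ ≤ 1 * (I / 4) := by
          refine mul_le_mul_of_nonneg_right ?_ (by positivity)
          have h1 : Real.exp (-τ ^ 2) * Real.exp (τ ^ 2 / 2) = (Real.exp (τ ^ 2 / 2))⁻¹ := by
            rw [← Real.exp_neg, ← Real.exp_add]; congr 1; ring
          rw [h1, ← div_eq_mul_inv]
          exact div_le_one_of_le₀ hm (Real.exp_pos _).le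
      _ = I / 4 := one_mul _
  linarith

end Gaussian

/-- A maximal separated subset is a net. -/
lemma exists_net_of_card_le {α : Type*} (S : Set α) (r : α → α → Prop) (hrefl : ∀ x, r x x)
    (hsymm : ∀ x y, r x y → r y x) (k : ℕ)
    (hk : ∀ P : Finset α, (∀ x ∈ P, x ∈ S) → (∀ x ∈ P, ∀ y ∈ P, x ≠ y → ¬ r x y) → P.card ≤ k) :
    ∃ P : Finset α, P.card ≤ k ∧ ∀ x ∈ S, ∃ y ∈ P, r x y := by
  classical
  set good : ℕ → Prop := fun n => ∃ P : Finset α, (∀ x ∈ P, x ∈ S) ∧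
    (∀ x ∈ P, ∀ y ∈ P, x ≠ y → ¬ r x y) ∧ P.card = n with hgood
  have h0 : good 0 := ⟨∅, by simp⟩
  obtain ⟨P, hPS, hPsep, hPc⟩ := Nat.findGreatest_spec (P := good) (Nat.zero_le k) h0
  refine ⟨P, hk P hPS hPsep, fun x hx => ?_⟩
  by_contra! hcon
  have hxP : x ∉ P := fun h => hcon x h (hrefl x)
  have hsep' : ∀ a ∈ insert x P, ∀ b ∈ insert x P, a ≠ b → ¬ r a b := by
    intro a ha b hb hab
    rcases Finset.mem_insert.1 ha with hax | ha
    · rcases Finset.mem_insert.1 hb with hbx | hb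
      · exact absurd (hax.trans hbx.symm) hab
      · exact hax ▸ hcon b hb
    · rcases Finset.mem_insert.1 hb with hbx | hb
      · exact fun h => hcon a ha (hsymm _ _ (hbx ▸ h))
      · exact hPsep a ha b hb hab
  have hS' : ∀ a ∈ insert x P, a ∈ S := by
    intro a ha
    rcases Finset.mem_insert.1 ha with rfl | ha
    exacts [hx, hPS a ha]
  have hgood' : good (P.card + 1) := ⟨insert x P, hS', hsep', Finset.card_insert_of_notMem hxP⟩
  have hle : P.card + 1 ≤ k := by
    rw [← Finset.card_insert_of_notMem hxP]
    exact hk _ hS' hsep'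
  have := Nat.le_findGreatest hle hgood'
  omega

/-- A set all of whose separated subsets have at most `k` elements splits into `k` cells, any two
points of a cell being close to a common point. -/
lemma exists_label_of_card_le {α : Type*} (S : Set α) (r : α → α → Prop) (hrefl : ∀ x, r x x)
    (hsymm : ∀ x y, r x y → r y x) (k : ℕ) (hk0 : 0 < k)
    (hk : ∀ P : Finset α, (∀ x ∈ P, x ∈ S) → (∀ x ∈ P, ∀ y ∈ P, x ≠ y → ¬ r x y) → P.card ≤ k) :
    ∃ ψ : α → ℕ, (∀ x, ψ x < k) ∧
      ∀ x ∈ S, ∀ y ∈ S, ψ x = ψ y → ∃ z, r x z ∧ r y z := by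
  classical
  obtain ⟨P, hPk, hP⟩ := exists_net_of_card_le S r hrefl hsymm k hk
  choose! f hfP hfr using hP
  refine ⟨fun x => if h : x ∈ S then (P.equivFin ⟨f x, hfP x h⟩ : ℕ) else 0, fun x => ?_,
    fun x hx y hy hxy => ⟨f x, hfr x hx, ?_⟩⟩
  · by_cases h : x ∈ S
    · simp only [h, dite_true]
      exact (Fin.is_lt _).trans_le hPk
    · simpa [h] using hk0
  · simp only [hx, hy, dite_true] at hxy
    have h1 := P.equivFin.injective (Fin.ext hxy)
    have h2 : f x = f y := congrArg Subtype.val h1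
    rw [h2]
    exact hfr y hy

/-! ### Entropy of the process -/

/-- The standing assumptions: `K` is a symmetric convex body contained in the ball of radius `D`,
the vectors `X j` have norm at most `H`, and `M` bounds
`(∑ j, |⟪X j, y⟫| ^ (2 (p - 1))) ^ (1 / 2)` for `y ∈ K`. -/
structure IsPowerProcess {E : Type*} [NormedAddCommGroup E] [InnerProductSpace ℝ E] {m : ℕ}
    (K : Set E) (X : Fin m → E) (p D H M : ℝ) : Prop where
  convex : Convex ℝ K
  isCompact : IsCompact K
  neg_mem : ∀ x ∈ K, -x ∈ K
  mem_nhds : K ∈ nhds (0 : E)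
  two_le : 2 ≤ p
  radius_pos : 0 < D
  norm_le : ∀ y ∈ K, ‖y‖ ≤ D
  bound_pos : 0 < H
  norm_vec_le : ∀ j, ‖X j‖ ≤ H
  weight_pos : 0 < M
  sum_le : ∀ y ∈ K, ∑ j, |inner ℝ (X j) y| ^ (2 * (p - 1)) ≤ M ^ 2

/-- The vector of signed `p`-th powers of the functionals `⟪X j, ·⟫`, in `ℓ₂`. The Euclidean
distance of its values dominates the canonical distance of the process
`∑ j, ε j |⟪X j, y⟫| ^ p`. -/
noncomputable def powerMap {E : Type*} [NormedAddCommGroup E] [InnerProductSpace ℝ E] {m : ℕ}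
    (X : Fin m → E) (p : ℝ) (x : E) : EuclideanSpace ℝ (Fin m) :=
  WithLp.toLp 2 fun j => signedPow p (inner ℝ (X j) x)

lemma sq_signedPow_sub_le {p : ℝ} (hp : 1 < p) (a b u : ℝ) :
    (signedPow p a - signedPow p b) ^ 2 ≤ p ^ 2 * 4 ^ (p - 1) * ((a - b) ^ 2 *
      (|u| ^ (2 * (p - 1)) + |a - u| ^ (2 * (p - 1)) + |b - u| ^ (2 * (p - 1)))) := by
  have hp' : 0 ≤ 2 * (p - 1) := by linarith
  set μ := max |u| (max |a - u| |b - u|) with hμ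
  have hu : |u| ≤ μ := le_max_left _ _
  have ha : |a - u| ≤ μ := (le_max_left _ _).trans (le_max_right _ _)
  have hb : |b - u| ≤ μ := (le_max_right _ _).trans (le_max_right _ _)
  have hμ0 : 0 ≤ μ := (abs_nonneg _).trans hu
  have hmax : max |a| |b| ≤ 2 * μ := by
    refine max_le ?_ ?_
    · have := abs_add_le (a - u) u
      rw [sub_add_cancel] at this
      linarith
    · have := abs_add_le (b - u) u
      rw [sub_add_cancel] at this
      linarith
  have h1 : (max |a| |b| ^ (p - 1)) ^ 2 ≤ 4 ^ (p - 1) * μ ^ (2 * (p - 1)) := by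
    calc (max |a| |b| ^ (p - 1)) ^ 2 ≤ ((2 * μ) ^ (p - 1)) ^ 2 :=
          pow_le_pow_left₀ (by positivity)
            (Real.rpow_le_rpow (by positivity) hmax (by linarith)) 2
      _ = 4 ^ (p - 1) * μ ^ (2 * (p - 1)) := by
          rw [← Real.rpow_mul_natCast (by positivity), mul_comm (p - 1), Nat.cast_ofNat,
            Real.mul_rpow (by norm_num) hμ0, Real.rpow_mul (by norm_num : (0 : ℝ) ≤ 2)]
          norm_num
  have h2 : μ ^ (2 * (p - 1)) ≤
      |u| ^ (2 * (p - 1)) + |a - u| ^ (2 * (p - 1)) + |b - u| ^ (2 * (p - 1)) := by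
    have n1 := Real.rpow_nonneg (abs_nonneg u) (2 * (p - 1))
    have n2 := Real.rpow_nonneg (abs_nonneg (a - u)) (2 * (p - 1))
    have n3 := Real.rpow_nonneg (abs_nonneg (b - u)) (2 * (p - 1))
    rcases max_choice |u| (max |a - u| |b - u|) with h | h
    · rw [hμ, h]; linarith
    · rcases max_choice |a - u| |b - u| with h' | h' <;> rw [hμ, h, h'] <;> linarith
  calc (signedPow p a - signedPow p b) ^ 2 = |signedPow p a - signedPow p b| ^ 2 := (sq_abs _).symm
    _ ≤ (p * |a - b| * max |a| |b| ^ (p - 1)) ^ 2 :=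
        pow_le_pow_left₀ (abs_nonneg _) (abs_signedPow_sub_le hp a b) 2
    _ = p ^ 2 * (a - b) ^ 2 * (max |a| |b| ^ (p - 1)) ^ 2 := by
        rw [mul_pow, mul_pow, sq_abs]
    _ ≤ p ^ 2 * (a - b) ^ 2 * (4 ^ (p - 1) * (|u| ^ (2 * (p - 1)) + |a - u| ^ (2 * (p - 1))
          + |b - u| ^ (2 * (p - 1)))) := by
        refine mul_le_mul_of_nonneg_left (h1.trans ?_) (by positivity)
        exact mul_le_mul_of_nonneg_left h2 (by positivity)
    _ = _ := by ring

section

variable {E : Type*} [NormedAddCommGroup E] [InnerProductSpace ℝ E] {m : ℕ}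
  {K : Set E} {X : Fin m → E} {p D H M : ℝ}

lemma dist_powerMap_sq (x y : E) : dist (powerMap X p x) (powerMap X p y) ^ 2
    = ∑ j, (signedPow p (inner ℝ (X j) x) - signedPow p (inner ℝ (X j) y)) ^ 2 := by
  rw [EuclideanSpace.dist_eq, Real.sq_sqrt (by positivity)]
  simp [powerMap, Real.dist_eq]

lemma continuous_powerMap (hp : 1 < p) : Continuous (powerMap X p) := by
  unfold powerMap
  refine (PiLp.continuous_toLp 2 _).comp (continuous_pi fun j => ?_)
  exact (continuous_signedPow hp).comp (by fun_prop)

namespace IsPowerProcess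

lemma one_lt (h : IsPowerProcess K X p D H M) : 1 < p := by linarith [h.two_le]

lemma zero_mem (h : IsPowerProcess K X p D H M) : (0 : E) ∈ K := mem_of_mem_nhds h.mem_nhds

lemma exists_smul_eq (h : IsPowerProcess K X p D H M) {x : E} {R : ℝ} (hR : 0 < R)
    (hx : gauge K x ≤ R) : ∃ k ∈ K, x = R • k := by
  refine ⟨R⁻¹ • x, ?_, by rw [smul_smul, mul_inv_cancel₀ hR.ne', one_smul]⟩
  rw [← h.isCompact.isClosed.closure_eq, ← gauge_le_one_iff_mem_closure h.convex h.mem_nhds,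
    gauge_smul_of_nonneg (inv_nonneg.2 hR.le), smul_eq_mul, inv_mul_le_iff₀ hR, mul_one]
  exact hx

lemma sum_le_of_gauge_le (h : IsPowerProcess K X p D H M) {x : E} {R : ℝ} (hR : 0 < R)
    (hx : gauge K x ≤ R) :
    ∑ j, |inner ℝ (X j) x| ^ (2 * (p - 1)) ≤ R ^ (2 * (p - 1)) * M ^ 2 := by
  obtain ⟨k, hk, rfl⟩ := h.exists_smul_eq hR hx
  refine le_trans (le_of_eq ?_) (mul_le_mul_of_nonneg_left (h.sum_le k hk) (by positivity))
  rw [Finset.mul_sum]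
  refine Finset.sum_congr rfl fun j _ => ?_
  rw [real_inner_smul_right, abs_mul, abs_of_pos hR, Real.mul_rpow hR.le (abs_nonneg _)]

lemma norm_le_of_gauge_le (h : IsPowerProcess K X p D H M) {x : E} {R : ℝ} (hR : 0 < R)
    (hx : gauge K x ≤ R) : ‖x‖ ≤ R * D := by
  obtain ⟨k, hk, rfl⟩ := h.exists_smul_eq hR hx
  rw [norm_smul, Real.norm_of_nonneg hR.le]
  exact mul_le_mul_of_nonneg_left (h.norm_le k hk) hR.le

/-- Near a point `u` of `K` the distance is controlled by a Hilbert norm with weights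
`|⟪X j, u⟫| ^ (p - 1)`, up to an error involving the maximum of the functionals and a power of
the `K`-distance to `u`. -/
lemma dist_powerMap_sq_le (h : IsPowerProcess K X p D H M) {x y u : E} {R T : ℝ} (hR : 0 < R)
    (hx : gauge K (x - u) ≤ R) (hy : gauge K (y - u) ≤ R)
    (hT : ∀ j, |inner ℝ (X j) (x - y)| ≤ T) :
    dist (powerMap X p x) (powerMap X p y) ^ 2 ≤ p ^ 2 * 4 ^ (p - 1) *
      (∑ j, (|inner ℝ (X j) u| ^ (p - 1)) ^ 2 * inner ℝ (X j) (x - y) ^ 2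
        + 2 * T ^ 2 * (R ^ (2 * (p - 1)) * M ^ 2)) := by
  have hsx := h.sum_le_of_gauge_le hR hx
  have hsy := h.sum_le_of_gauge_le hR hy
  rw [dist_powerMap_sq]
  calc _ ≤ ∑ j, p ^ 2 * 4 ^ (p - 1) * (inner ℝ (X j) (x - y) ^ 2 *
      (|inner ℝ (X j) u| ^ (2 * (p - 1)) + |inner ℝ (X j) (x - u)| ^ (2 * (p - 1))
        + |inner ℝ (X j) (y - u)| ^ (2 * (p - 1)))) := by
        refine Finset.sum_le_sum fun j _ => ?_
        simp only [inner_sub_right]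
        exact sq_signedPow_sub_le h.one_lt _ _ _
    _ ≤ ∑ j, p ^ 2 * 4 ^ (p - 1) * ((|inner ℝ (X j) u| ^ (p - 1)) ^ 2 * inner ℝ (X j) (x - y) ^ 2
      + T ^ 2 * (|inner ℝ (X j) (x - u)| ^ (2 * (p - 1))
        + |inner ℝ (X j) (y - u)| ^ (2 * (p - 1)))) := by
        refine Finset.sum_le_sum fun j _ => mul_le_mul_of_nonneg_left ?_ (by positivity)
        have h1 : |inner ℝ (X j) u| ^ (2 * (p - 1)) = (|inner ℝ (X j) u| ^ (p - 1)) ^ 2 := by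
          rw [← Real.rpow_mul_natCast (abs_nonneg _), mul_comm (2 : ℝ), Nat.cast_ofNat]
        have h2 : inner ℝ (X j) (x - y) ^ 2 ≤ T ^ 2 := by
          rw [← sq_abs]
          exact pow_le_pow_left₀ (abs_nonneg _) (hT j) 2
        rw [add_assoc, mul_add, h1, mul_comm (_ ^ 2)]
        gcongr
    _ ≤ _ := by
        rw [← Finset.mul_sum, Finset.sum_add_distrib, ← Finset.mul_sum, Finset.sum_add_distrib]
        refine mul_le_mul_of_nonneg_left ?_ (by positivity)
        nlinarith [mul_le_mul_of_nonneg_left (add_le_add hsx hsy) (sq_nonneg T)]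

lemma inner_sq_sum_sub_le (w : Fin m → ℝ) (a b : E) :
    ∑ j, w j ^ 2 * inner ℝ (X j) (a - b) ^ 2
      ≤ 2 * ∑ j, w j ^ 2 * inner ℝ (X j) a ^ 2 + 2 * ∑ j, w j ^ 2 * inner ℝ (X j) b ^ 2 := by
  rw [Finset.mul_sum, Finset.mul_sum, ← Finset.sum_add_distrib]
  refine Finset.sum_le_sum fun j _ => ?_
  rw [inner_sub_right]
  nlinarith [mul_nonneg (sq_nonneg (w j)) (sq_nonneg (inner ℝ (X j) a + inner ℝ (X j) b))]

lemma two_mul_exp_two_pow_le (n : ℕ) :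
    2 * Real.exp ((2 : ℝ) ^ n / 2) ≤ ((2 ^ 2 ^ (n + 1) : ℕ) : ℝ) := by
  have h1 : Real.exp ((2 : ℝ) ^ n / 2) ≤ 2 ^ 2 ^ n := by
    have h2 : Real.exp (1 / 2) ≤ 2 := by
      have h := Real.exp_one_lt_d9
      have h' : Real.exp (1 / 2) ^ 2 = Real.exp 1 := by
        rw [← Real.exp_nat_mul]; norm_num
      nlinarith [Real.exp_pos (1 / 2)]
    calc Real.exp ((2 : ℝ) ^ n / 2) = Real.exp (1 / 2) ^ 2 ^ n := by
          rw [← Real.exp_nat_mul]; congr 1; push_cast; ring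
      _ ≤ 2 ^ 2 ^ n := pow_le_pow_left₀ (Real.exp_pos _).le h2 _
  have h3 : (2 : ℝ) ≤ 2 ^ 2 ^ n := by
    calc (2 : ℝ) = 2 ^ 1 := by norm_num
      _ ≤ 2 ^ 2 ^ n := pow_le_pow_right₀ (by norm_num) Nat.one_le_two_pow
  push_cast
  rw [pow_succ 2 n, pow_mul, sq]
  exact mul_le_mul h3 h1 (Real.exp_pos _).le (by positivity)

/-- The entropy estimate: a subset of `K` of `K`-radius `R` splits into `2 ^ 2 ^ (n + 1)` pieces of
small diameter. The weighted Hilbert norm produces the term `R`, free of logarithms; only the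
higher order term `R ^ p` carries the logarithmic factor `Λ`. -/
lemma exists_label_of_gauge_le [FiniteDimensional ℝ E] (h : IsPowerProcess K X p D H M)
    {Λ R : ℝ} (hΛ : 0 < Λ) (hm : 8 * (m : ℝ) ≤ Real.exp (2 * Λ)) (hR : 0 < R) {u : E}
    (hu : u ∈ K) (G : Set E) (hG : ∀ x ∈ G, gauge K (x - u) ≤ R) (n : ℕ) :
    ∃ ψ : E → ℕ, (∀ x, ψ x < 2 ^ 2 ^ (n + 1)) ∧ ∀ x ∈ G, ∀ y ∈ G, ψ x = ψ y →
      dist (powerMap X p x) (powerMap X p y)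
        ≤ 16 ^ p * (D * H * M) / √2 ^ n * (R + √Λ * R ^ p) := by
  let _ : MeasurableSpace E := borel E
  have _ : BorelSpace E := ⟨rfl⟩
  have hD := h.radius_pos
  have hH := h.bound_pos
  have hM := h.weight_pos
  set b : ℝ := √2 ^ n with hb
  have hbpos : 0 < b := by positivity
  have hb2 : b ^ 2 = 2 ^ n := by
    rw [hb, ← pow_mul, mul_comm, pow_mul, Real.sq_sqrt (by norm_num)]
  set w : Fin m → ℝ := fun j => |inner ℝ (X j) u| ^ (p - 1) with hw
  set τ : ℝ := 2 * √Λ with hτ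
  have hτpos : 0 < τ := by positivity
  have hτ2 : τ ^ 2 = 4 * Λ := by rw [hτ, mul_pow, Real.sq_sqrt hΛ.le]; norm_num
  have hwM : ∑ j, w j ^ 2 ≤ M ^ 2 := by
    refine le_trans (le_of_eq (Finset.sum_congr rfl fun j _ => ?_)) (h.sum_le u hu)
    rw [hw, ← Real.rpow_mul_natCast (abs_nonneg _), mul_comm (2 : ℝ), Nat.cast_ofNat]
  -- dilating by `κ` maps the Euclidean ball of radius `R D` to the ball of radius `b`
  set κ : ℝ := b / (R * D) with hκ
  have hκpos : 0 < κ := by positivity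
  set r : E → E → Prop := fun x y =>
    κ ^ 2 * ∑ j, w j ^ 2 * inner ℝ (X j) (x - y) ^ 2 ≤ 64 * (H * M) ^ 2 ∧
      ∀ j, κ * |inner ℝ (X j) (x - y)| ≤ 2 * (τ * H) with hr
  have hrefl : ∀ x, r x x := fun x => by
    refine ⟨?_, fun j => ?_⟩
    · simp only [sub_self, inner_zero_right]
      simp only [ne_eq, OfNat.ofNat_ne_zero, not_false_eq_true, zero_pow, mul_zero,
        Finset.sum_const_zero]
      positivity
    · simp only [sub_self, inner_zero_right, abs_zero, mul_zero]
      positivity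
  have hsymm : ∀ x y, r x y → r y x := fun x y hxy => by
    have hneg : ∀ j, (inner ℝ (X j) (y - x) : ℝ) = -inner ℝ (X j) (x - y) := fun j => by
      rw [← inner_neg_right, neg_sub]
    simpa only [hr, hneg, neg_sq, abs_neg] using hxy
  obtain ⟨ψ, hψ, hψr⟩ := exists_label_of_card_le G r hrefl hsymm (2 ^ 2 ^ (n + 1)) (by positivity)
    (by
      intro P hPG hPsep
      classical
      have hinj : Function.Injective fun x : E => κ • (x - u) := fun x y hxy => by
        simpa using smul_right_injective E hκpos.ne' hxy
      have hcard := card_le_of_disjoint_translates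
        (B := {z : E | ∑ j, w j ^ 2 * inner ℝ (X j) z ^ 2 ≤ 16 * (H * M) ^ 2 ∧
          ∀ j, |inner ℝ (X j) z| ≤ τ * H}) ?_ ?_
        (half_le_gaussian_mass hH h.norm_vec_le hM hwM hτpos
          (by rw [hτ2]; convert hm using 2; ring))
        (P.image fun x => κ • (x - u)) (ϱ := b) ?_ ?_
      · rw [Finset.card_image_of_injective _ hinj, hb2] at hcard
        exact_mod_cast hcard.trans (two_mul_exp_two_pow_le n)
      · refine IsClosed.measurableSet ?_
        rw [Set.ofPred_and, Set.ofPred_forall]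
        exact (isClosed_le (by fun_prop) continuous_const).inter
          (isClosed_iInter fun j => isClosed_le (by fun_prop) continuous_const)
      · intro z hz
        simpa using hz
      · intro y hy
        obtain ⟨x, hx, rfl⟩ := Finset.mem_image.1 hy
        rw [norm_smul, Real.norm_of_nonneg hκpos.le, hκ, div_mul_eq_mul_div,
          div_le_iff₀ (by positivity)]
        exact mul_le_mul_of_nonneg_left (h.norm_le_of_gauge_le hR (hG x (hPG x hx))) hbpos.le
      · intro y hy y' hy' hne z hz hz'
        obtain ⟨x, hx, rfl⟩ := Finset.mem_image.1 hy
        obtain ⟨x', hx', rfl⟩ := Finset.mem_image.1 hy'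
        refine hPsep x hx x' hx' (fun hxx => hne (by rw [hxx])) ?_
        have hdiff : (z - κ • (x' - u)) - (z - κ • (x - u)) = κ • (x - x') := by
          simp only [smul_sub]; abel
        refine ⟨?_, fun j => ?_⟩
        · have h1 := inner_sq_sum_sub_le (X := X) w (z - κ • (x' - u)) (z - κ • (x - u))
          have h2 : ∑ j, w j ^ 2 * inner ℝ (X j) (κ • (x - x')) ^ 2
              = κ ^ 2 * ∑ j, w j ^ 2 * inner ℝ (X j) (x - x') ^ 2 := by
            rw [Finset.mul_sum]
            refine Finset.sum_congr rfl fun j _ => ?_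
            rw [real_inner_smul_right]; ring
          rw [hdiff, h2] at h1
          have h3 := hz.1
          have h4 := hz'.1
          linarith
        · have h1 : κ * |inner ℝ (X j) (x - x')| = |inner ℝ (X j) (z - κ • (x' - u))
              - inner ℝ (X j) (z - κ • (x - u))| := by
            rw [← inner_sub_right, hdiff, real_inner_smul_right, abs_mul, abs_of_pos hκpos]
          rw [h1]
          have h2 := abs_sub (inner ℝ (X j) (z - κ • (x' - u)) : ℝ)
            (inner ℝ (X j) (z - κ • (x - u)))
          have h3 := hz.2 j
          have h4 := hz'.2 j
          linarith)
  refine ⟨ψ, hψ, fun x hx y hy hxy => ?_⟩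
  obtain ⟨z, hxz, hyz⟩ := hψr x hx y hy hxy
  have hdiff : x - y = (x - z) - (y - z) := by abel
  have hT : ∀ j, |inner ℝ (X j) (x - y)| ≤ 4 * (τ * H) / κ := fun j => by
    rw [le_div_iff₀ hκpos, hdiff, inner_sub_right]
    have h1 := hxz.2 j
    have h2 := hyz.2 j
    have h3 := mul_le_mul_of_nonneg_left
      (abs_sub (inner ℝ (X j) (x - z) : ℝ) (inner ℝ (X j) (y - z))) hκpos.le
    linarith
  have hQ : ∑ j, w j ^ 2 * inner ℝ (X j) (x - y) ^ 2 ≤ 256 * (H * M) ^ 2 / κ ^ 2 := by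
    rw [le_div_iff₀ (by positivity), hdiff]
    have h1 := inner_sq_sum_sub_le (X := X) w (x - z) (y - z)
    have h2 := mul_le_mul_of_nonneg_left h1 (sq_nonneg κ)
    have h3 := hxz.1
    have h4 := hyz.1
    linarith
  have hd := h.dist_powerMap_sq_le hR (hG x hx) (hG y hy) hT
  have hp2 := h.two_le
  have hconst : p ^ 2 * 4 ^ (p - 1) * 256 ≤ ((16 : ℝ) ^ p) ^ 2 := by
    have h1 : p ^ 2 ≤ 4 ^ p := by
      have := one_add_mul_self_le_rpow_one_add (s := 1) (by norm_num) h.one_lt.le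
      have h2 : p ≤ 2 ^ p := by norm_num at this; linarith
      calc p ^ 2 ≤ (2 ^ p) ^ 2 := pow_le_pow_left₀ (by linarith) h2 2
        _ = 4 ^ p := by
            rw [← Real.rpow_mul_natCast (by norm_num), mul_comm, Real.rpow_mul (by norm_num)]
            norm_num
    have h2 : (16 : ℝ) ^ p = 4 ^ p * 4 ^ p := by
      rw [← Real.mul_rpow (by norm_num) (by norm_num)]; norm_num
    have h3 : (64 : ℝ) ≤ 16 ^ p := by
      calc (64 : ℝ) ≤ 16 ^ (2 : ℝ) := by norm_num
        _ ≤ 16 ^ p := Real.rpow_le_rpow_of_exponent_le (by norm_num) hp2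
    have h4 : (4 : ℝ) ^ (p - 1) = 4 ^ p / 4 := Real.rpow_sub_one (by norm_num) p
    rw [h4]
    have h5 : 0 < (4 : ℝ) ^ p := by positivity
    calc p ^ 2 * (4 ^ p / 4) * 256 ≤ 4 ^ p * (4 ^ p / 4) * 256 := by gcongr
      _ = 16 ^ p * 64 := by rw [h2]; ring
      _ ≤ (16 ^ p) ^ 2 := by rw [sq]; gcongr
  have hRp : R ^ (2 * (p - 1)) * R ^ 2 = (R ^ p) ^ 2 := by
    rw [← Real.rpow_mul_natCast hR.le, ← Real.rpow_natCast R 2, ← Real.rpow_add hR]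
    congr 1; push_cast; ring
  refine le_of_sq_le_sq ?_ (by positivity)
  calc _ ≤ _ := hd
    _ ≤ p ^ 2 * 4 ^ (p - 1) * (256 * (H * M) ^ 2 / κ ^ 2
        + 2 * (4 * (τ * H) / κ) ^ 2 * (R ^ (2 * (p - 1)) * M ^ 2)) := by gcongr
    _ = p ^ 2 * 4 ^ (p - 1) * 256 * ((D * H * M / b) ^ 2 *
        (R ^ 2 + 1 / 8 * τ ^ 2 * (R ^ (2 * (p - 1)) * R ^ 2))) := by
        rw [hκ]
        field_simp
        ring
    _ ≤ ((16 : ℝ) ^ p) ^ 2 * ((D * H * M / b) ^ 2 * (R + √Λ * R ^ p) ^ 2) := by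
        refine mul_le_mul hconst ?_ (by positivity) (by positivity)
        refine mul_le_mul_of_nonneg_left ?_ (by positivity)
        rw [hRp, hτ2, add_sq, mul_pow, Real.sq_sqrt hΛ.le]
        have : 0 ≤ 2 * R * (√Λ * R ^ p) := by positivity
        have : 0 ≤ Λ * (R ^ p) ^ 2 := by positivity
        linarith
    _ = _ := by ring

end IsPowerProcess
end

/-! ### Interpolation and uniform convexity -/

lemma dist_powerMap_midpoint_le {E : Type*} [NormedAddCommGroup E] [InnerProductSpace ℝ E] {m : ℕ}
    {X : Fin m → E} {p : ℝ} (hp : 1 < p) (x y : E) :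
    dist (powerMap X p x) (powerMap X p ((2 : ℝ)⁻¹ • (x + y)))
      ≤ dist (powerMap X p x) (powerMap X p y) := by
  refine le_of_sq_le_sq ?_ dist_nonneg
  rw [dist_powerMap_sq, dist_powerMap_sq]
  refine Finset.sum_le_sum fun j _ => ?_
  rw [sq_le_sq, real_inner_smul_right, inner_add_right]
  exact abs_signedPow_sub_midpoint_le hp _ _

/-- `y` is a minimizer over `K` of the interpolation functional
`gauge K y ^ q + t * dist (F x) (F y)`. -/
structure IsInterpolant {E α : Type*} [AddCommGroup E] [Module ℝ E] [PseudoMetricSpace α]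
    (K : Set E) (F : E → α) (q t : ℝ) (x y : E) : Prop where
  mem : y ∈ K
  le : ∀ z ∈ K, gauge K y ^ q + t * dist (F x) (F y) ≤ gauge K z ^ q + t * dist (F x) (F z)

section Interpolation

variable {E : Type*} [NormedAddCommGroup E] [InnerProductSpace ℝ E] {m : ℕ}
  {K : Set E} {X : Fin m → E} {p D H M : ℝ}

lemma IsPowerProcess.exists_isInterpolant (h : IsPowerProcess K X p D H M) {q : ℝ} (hq : 0 ≤ q)
    (t : ℝ) (x : E) : ∃ y, IsInterpolant K (powerMap X p) q t x y := by
  have hF := continuous_powerMap (X := X) h.one_lt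
  have hg := (continuous_gauge h.convex h.mem_nhds).rpow_const fun _ => Or.inr hq
  obtain ⟨y, hy, hmin⟩ := h.isCompact.exists_isMinOn ⟨0, h.zero_mem⟩
    (f := fun y => gauge K y ^ q + t * dist (powerMap X p x) (powerMap X p y))
    (by fun_prop : Continuous _).continuousOn
  exact ⟨y, hy, fun z hz => hmin hz⟩

/-- Uniform convexity improves on the trivial bound for the `K`-distance of two interpolants:
comparing each of them with their midpoint leaves only the distance between them. -/
lemma IsPowerProcess.gauge_sub_rpow_le (h : IsPowerProcess K X p D H M) {q lam t : ℝ}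
    (hlam : 0 < lam) (hconv : HasConvexityPowerType K q lam) (ht : 0 ≤ t) {x₁ x₂ y₁ y₂ : E}
    (h₁ : IsInterpolant K (powerMap X p) q t x₁ y₁)
    (h₂ : IsInterpolant K (powerMap X p) q t x₂ y₂) :
    gauge K (y₁ - y₂) ^ q ≤ (2 * lam) ^ q * (t * dist (powerMap X p y₁) (powerMap X p y₂)) := by
  set F := powerMap X p
  set z := (2 : ℝ)⁻¹ • (y₁ + y₂) with hz
  have hzK : z ∈ K := by
    rw [hz, smul_add]
    exact h.convex h₁.mem h₂.mem (by norm_num) (by norm_num) (by norm_num)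
  have hmid : ∀ {x y y' : E}, IsInterpolant K F q t x y → dist (F y) (F z) ≤ dist (F y) (F y') →
      gauge K y ^ q ≤ gauge K z ^ q + t * dist (F y) (F y') := fun {x y y'} hy hd => by
    have e1 := hy.le z hzK
    have e2 := mul_le_mul_of_nonneg_left (dist_triangle (F x) (F y) (F z)) ht
    have e3 := mul_le_mul_of_nonneg_left hd ht
    linarith
  have k1 := hmid h₁ (dist_powerMap_midpoint_le h.one_lt y₁ y₂)
  have k2 := hmid h₂ (y' := y₁) (by
    rw [hz, add_comm]; exact dist_powerMap_midpoint_le h.one_lt y₂ y₁)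
  rw [dist_comm (F y₂)] at k2
  have hc := hconv y₁ y₂
  rw [← hz] at hc
  have hhalf : gauge K (y₁ - y₂) = 2 * gauge K ((2 : ℝ)⁻¹ • (y₁ - y₂)) := by
    rw [gauge_smul_of_nonneg (by norm_num), smul_eq_mul]; ring
  have hkey : lam ^ (-q) * gauge K ((2 : ℝ)⁻¹ • (y₁ - y₂)) ^ q ≤ t * dist (F y₁) (F y₂) := by
    linarith
  rw [hhalf, Real.mul_rpow (by norm_num) (gauge_nonneg _), Real.mul_rpow (by norm_num) hlam.le,
    mul_assoc]
  refine mul_le_mul_of_nonneg_left ?_ (by positivity)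
  have hlq : 0 < lam ^ q := Real.rpow_pos_of_pos hlam q
  rwa [Real.rpow_neg hlam.le, inv_mul_le_iff₀ hlq] at hkey

/-- The interpolation values increase with the level and stay below `1`, so the interpolation
errors are summable with weights `√2 ^ n`. -/
lemma IsPowerProcess.sum_dist_isInterpolant_le {q c : ℝ} (hq : 0 ≤ q) (hc : 0 < c)
    {π : ℕ → E → E} (hπ : ∀ n x, IsInterpolant K (powerMap X p) q (c * √2 ^ n) x (π n x))
    {x : E} (hx : x ∈ K) (N : ℕ) :
    ∑ n ∈ Finset.range (N + 1), √2 ^ n * dist (powerMap X p x) (powerMap X p (π n x)) ≤ 4 / c := by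
  set F := powerMap X p
  set V : ℕ → ℝ := fun n => gauge K (π n x) ^ q + c * √2 ^ n * dist (F x) (F (π n x)) with hV
  have hsqrt : (4 : ℝ) / 3 ≤ √2 := Real.le_sqrt_of_sq_le (by norm_num)
  have hsum : ∀ N, c / 4 * ∑ n ∈ Finset.range (N + 1), √2 ^ n * dist (F x) (F (π n x)) ≤ V N := by
    intro N
    induction N with
    | zero =>
      have := Real.rpow_nonneg (gauge_nonneg (s := K) (π 0 x)) q
      have h2 : 0 ≤ c * dist (F x) (F (π 0 x)) := by positivity
      simp only [hV, zero_add, Finset.sum_range_one, pow_zero, one_mul, mul_one]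
      linarith
    | succ N ih =>
      rw [Finset.sum_range_succ, mul_add]
      have h1 := (hπ N x).le (π (N + 1) x) (hπ (N + 1) x).mem
      have h2 : 0 ≤ c * √2 ^ N * dist (F x) (F (π (N + 1) x)) := by positivity
      have h3 : V (N + 1) = gauge K (π (N + 1) x) ^ q
          + √2 * (c * √2 ^ N * dist (F x) (F (π (N + 1) x))) := by
        simp only [hV, pow_succ]; ring
      have h4 : c / 4 * (√2 ^ (N + 1) * dist (F x) (F (π (N + 1) x)))
          = √2 / 4 * (c * √2 ^ N * dist (F x) (F (π (N + 1) x))) := by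
        rw [pow_succ]; ring
      rw [h3, h4]
      have h5 := mul_le_mul_of_nonneg_right hsqrt h2
      simp only [hV] at ih
      linarith
  have hle : V N ≤ 1 := by
    refine ((hπ N x).le x hx).trans ?_
    rw [dist_self, mul_zero, add_zero]
    exact Real.rpow_le_one (gauge_nonneg _) (gauge_le_one_of_mem hx) hq
  rw [le_div_iff₀ hc]
  linarith [hsum N]

lemma IsInterpolant.dist_le {α : Type*} [PseudoMetricSpace α] {F : E → α} {q t : ℝ} (hq : 0 ≤ q)
    (ht : 0 < t) {x y : E} (h : IsInterpolant K F q t x y) (hx : x ∈ K) :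
    dist (F x) (F y) ≤ t⁻¹ := by
  have h1 := h.le x hx
  rw [dist_self, mul_zero, add_zero] at h1
  have h2 := Real.rpow_le_one (gauge_nonneg _) (gauge_le_one_of_mem hx) hq
  have h3 := Real.rpow_nonneg (gauge_nonneg (s := K) y) q
  rw [← one_div, le_div_iff₀ ht]
  linarith

end Interpolation

/-- Young's inequality turns the entropy bound, with radius `2 lam V ^ (1 / q)` coming from uniform
convexity, into a small multiple of `V` plus a constant `1 / N` that may be summed over `N`
levels. -/
lemma radius_add_le_of_young {p q q' lam A Λ c V N : ℝ} (hq : 2 ≤ q) (hqp : q ≤ p)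
    (hqq : q.HolderConjugate q') (hlam : 1 ≤ lam) (hA : 0 < A) (hc : 0 < c) (hN : 1 ≤ N)
    (hNΛ : N ≤ Λ) (hV : 0 < V) (hcA : c * (256 ^ p * lam ^ p * A * Λ ^ (1 / q')) ≤ 1) :
    c * (16 ^ p * A * (min 2 (2 * lam * V ^ (1 / q))
      + √Λ * min 2 (2 * lam * V ^ (1 / q)) ^ p)) ≤ V / 4 + 1 / N := by
  have hN0 : 0 < N := by linarith
  have hΛ1 : 1 ≤ Λ := hN.trans hNΛ
  have hq0 : 0 < q := by linarith
  have hq'0 : 0 < q' := hqq.symm.pos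
  have hlam0 : 0 < lam := by linarith
  have hsum : 1 / q + 1 / q' = 1 := by simpa using hqq.inv_add_inv_eq_one
  have h256 : (256 : ℝ) ^ p = 16 ^ p * 16 ^ p := by
    rw [← Real.mul_rpow (by norm_num) (by norm_num)]; norm_num
  have h16 : (16 : ℝ) ≤ 2 ^ p * 2 ^ p := by
    rw [← Real.mul_rpow (by norm_num) (by norm_num)]
    calc (16 : ℝ) = (2 * 2) ^ (2 : ℝ) := by norm_num
      _ ≤ (2 * 2) ^ p := Real.rpow_le_rpow_of_exponent_le (by norm_num) (by linarith)
  have h16' : (16 : ℝ) * 2 ^ p ≤ 16 ^ p := by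
    calc (16 : ℝ) * 2 ^ p ≤ 2 ^ p * 2 ^ p * 2 ^ p := by gcongr
      _ = 8 ^ p := by
          rw [← Real.mul_rpow (by norm_num) (by norm_num),
            ← Real.mul_rpow (by norm_num) (by norm_num)]; norm_num
      _ ≤ 16 ^ p := Real.rpow_le_rpow (by norm_num) (by norm_num) (by linarith)
  have h2p : (1 : ℝ) ≤ 2 ^ p := Real.one_le_rpow (by norm_num) (by linarith)
  have hlp : lam ≤ lam ^ p := by
    simpa using Real.rpow_le_rpow_of_exponent_le hlam (show 1 ≤ p by linarith)
  have hlqp : lam ^ q ≤ lam ^ p := Real.rpow_le_rpow_of_exponent_le hlam hqp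
  have hsqrt : √Λ ≤ Λ ^ (1 / q') := by
    rw [Real.sqrt_eq_rpow]
    refine Real.rpow_le_rpow_of_exponent_le hΛ1 ?_
    have : 1 / q ≤ 1 / 2 := one_div_le_one_div_of_le (by norm_num) hq
    linarith
  set R := min 2 (2 * lam * V ^ (1 / q)) with hR
  have hR0 : 0 < R := by positivity
  -- the linear term
  have hlin : c * (16 ^ p * A * R) ≤ V / 8 + 1 / N := by
    have hyoung := Real.geom_mean_le_arith_mean2_weighted (one_div_nonneg.2 hq0.le)
      (one_div_nonneg.2 hq'0.le) hV.le (one_div_nonneg.2 hN0.le) hsum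
    have hVN : V ^ (1 / q) ≤ Λ ^ (1 / q') * (V + 1 / N) := by
      have e1 : (1 / N) ^ (1 / q') * N ^ (1 / q') = 1 := by
        rw [← Real.mul_rpow (by positivity) hN0.le, one_div_mul_cancel hN0.ne', Real.one_rpow]
      have e2 : 1 / q * V + 1 / q' * (1 / N) ≤ V + 1 / N := by
        have a1 : 1 / q ≤ 1 := by linarith [one_div_pos.2 hq'0]
        have a2 : 1 / q' ≤ 1 := by linarith [one_div_pos.2 hq0]
        exact add_le_add (mul_le_of_le_one_left hV.le a1)
          (mul_le_of_le_one_left (by positivity) a2)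
      calc V ^ (1 / q) = N ^ (1 / q') * (V ^ (1 / q) * (1 / N) ^ (1 / q')) := by
            rw [mul_left_comm, mul_comm (N ^ _), e1, mul_one]
        _ ≤ Λ ^ (1 / q') * (V + 1 / N) := by
            refine mul_le_mul (Real.rpow_le_rpow hN0.le hNΛ (by positivity))
              (hyoung.trans e2) (by positivity) (by positivity)
    have hstep : c * (16 ^ p * A * R)
        ≤ c * (256 ^ p * lam ^ p * A * Λ ^ (1 / q')) * ((V + 1 / N) / 8) := by
      have : (16 : ℝ) ≤ 16 ^ p := by nlinarith
      calc c * (16 ^ p * A * R)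
          ≤ c * (16 ^ p * A * (2 * lam ^ p * (Λ ^ (1 / q') * (V + 1 / N)))) := by
            gcongr
            refine (min_le_right _ _).trans ?_
            gcongr
        _ = c * (16 * 16 ^ p * lam ^ p * A * Λ ^ (1 / q')) * ((V + 1 / N) / 8) := by ring
        _ ≤ _ := by
            rw [h256]
            gcongr
    have hpos : 0 ≤ (V + 1 / N) / 8 := by positivity
    have := mul_le_of_le_one_left hpos hcA
    have : 0 < 1 / N := by positivity
    linarith
  -- the term of order `p ≥ q`
  have hpow : c * (16 ^ p * A * (√Λ * R ^ p)) ≤ V / 8 := by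
    have hRp : R ^ p ≤ 2 ^ p * lam ^ p * V := by
      have e1 : R ^ p = R ^ (p - q) * R ^ q := by rw [← Real.rpow_add hR0]; congr 1; ring
      have e2 : R ^ (p - q) ≤ 2 ^ (p - q) :=
        Real.rpow_le_rpow hR0.le (min_le_left _ _) (by linarith)
      have e3 : R ^ q ≤ 2 ^ q * lam ^ q * V := by
        refine (Real.rpow_le_rpow hR0.le (min_le_right _ _) hq0.le).trans (le_of_eq ?_)
        rw [Real.mul_rpow (by positivity) (by positivity), Real.mul_rpow (by norm_num) hlam0.le,
          ← Real.rpow_mul hV.le, one_div_mul_cancel hq0.ne', Real.rpow_one]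
      have e4 : (2 : ℝ) ^ p = 2 ^ (p - q) * 2 ^ q := by
        rw [← Real.rpow_add (by norm_num)]; congr 1; ring
      calc R ^ p ≤ 2 ^ (p - q) * (2 ^ q * lam ^ q * V) := by
            rw [e1]; exact mul_le_mul e2 e3 (by positivity) (by positivity)
        _ = 2 ^ p * lam ^ q * V := by rw [e4]; ring
        _ ≤ _ := by gcongr
    have hstep : c * (16 ^ p * A * (√Λ * R ^ p))
        ≤ c * (256 ^ p * lam ^ p * A * Λ ^ (1 / q')) * (V / 8) := by
      calc c * (16 ^ p * A * (√Λ * R ^ p))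
          ≤ c * (16 ^ p * A * (Λ ^ (1 / q') * (2 ^ p * lam ^ p * V))) := by gcongr
        _ = c * (16 ^ p * (8 * 2 ^ p) * lam ^ p * A * Λ ^ (1 / q')) * (V / 8) := by ring
        _ ≤ _ := by
            rw [h256]
            gcongr
            linarith
    exact hstep.trans (mul_le_of_le_one_left (by positivity) hcA)
  rw [mul_add, mul_add]
  linarith

/-! ### The contraction step -/

section Partition

variable {E : Type*} [NormedAddCommGroup E] [InnerProductSpace ℝ E] {m : ℕ}
  {K : Set E} {X : Fin m → E} {p D H M : ℝ}

lemma IsPowerProcess.isBounded_image (h : IsPowerProcess K X p D H M) {B : Set E} (hB : B ⊆ K) :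
    Bornology.IsBounded (powerMap X p '' B) :=
  ((h.isCompact.image (continuous_powerMap h.one_lt)).isBounded).subset (Set.image_mono hB)

lemma IsPowerProcess.gauge_sub_le_two (h : IsPowerProcess K X p D H M) {x y : E} (hx : x ∈ K)
    (hy : y ∈ K) : gauge K (x - y) ≤ 2 := by
  rw [sub_eq_add_neg]
  have h1 := gauge_add_le h.convex (absorbent_nhds_zero h.mem_nhds) x (-y)
  have h2 := gauge_le_one_of_mem hx
  have h3 := gauge_le_one_of_mem (h.neg_mem y hy)
  linarith

lemma two_pow_add_one_mul_le (n : ℕ) : (2 ^ n + 1) * 2 ^ 2 ^ (n + 1) ≤ 2 ^ 2 ^ (n + 2) := by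
  have h1 : 2 ^ n + 1 ≤ 2 ^ 2 ^ n := Nat.lt_two_pow_self
  calc (2 ^ n + 1) * 2 ^ 2 ^ (n + 1) ≤ 2 ^ 2 ^ n * 2 ^ 2 ^ (n + 1) := Nat.mul_le_mul_right _ h1
    _ = 2 ^ (2 ^ n + 2 ^ (n + 1)) := (pow_add _ _ _).symm
    _ ≤ 2 ^ 2 ^ (n + 2) := by
        refine Nat.pow_le_pow_right (by norm_num) ?_
        rw [pow_add, pow_add]
        omega

/-- The contraction step. The interpolants of a cell `B` whose interpolation error has a given
order of magnitude form a set of small `K`-radius, hence of small entropy; partitioning them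
partitions `B` into pieces whose diameter is a fraction of that of `B`, up to summable errors. -/
lemma IsPowerProcess.exists_label_diam_le [FiniteDimensional ℝ E] (h : IsPowerProcess K X p D H M)
    {q q' lam Λ c N : ℝ} (hq : 2 ≤ q) (hqp : q ≤ p) (hqq : q.HolderConjugate q') (hlam : 1 ≤ lam)
    (hconv : HasConvexityPowerType K q lam) (hc : 0 < c) (hN : 1 ≤ N) (hNΛ : N ≤ Λ)
    (hm : 8 * (m : ℝ) ≤ Real.exp (2 * Λ))
    (hcA : c * (256 ^ p * lam ^ p * (D * H * M) * Λ ^ (1 / q')) ≤ 1) {π : ℕ → E → E}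
    (hπ : ∀ n x, IsInterpolant K (powerMap X p) q (c * √2 ^ n) x (π n x))
    (n : ℕ) {B : Set E} (hB : B ⊆ K) :
    ∃ ψ : E → ℕ, (∀ x, ψ x < 2 ^ 2 ^ (n + 2)) ∧
      ∀ x ∈ B, ∀ y ∈ B, ∀ z ∈ B, ψ y = ψ x → ψ z = ψ x →
        dist (powerMap X p y) (powerMap X p z) ≤ Metric.diam (powerMap X p '' B) / 4
          + 3 * dist (powerMap X p x) (powerMap X p (π n x)) + 5 / (2 ^ n * (c * √2 ^ n))
          + 1 / (N * (c * √2 ^ n)) := by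
  classical
  set F := powerMap X p with hF
  set A := D * H * M with hA
  have hApos : 0 < A := mul_pos (mul_pos h.radius_pos h.bound_pos) h.weight_pos
  have hq0 : 0 < q := by linarith
  have hlam0 : 0 < lam := by linarith
  have hb : 0 < √2 ^ n := by positivity
  set t := c * √2 ^ n with ht
  have htpos : 0 < t := by positivity
  set σ : ℝ := 1 / (2 ^ n * t) with hσ
  have hσpos : 0 < σ := by positivity
  set s : E → ℝ := fun x => dist (F x) (F (π n x)) with hs
  set κ : E → ℕ := fun x => ⌊s x / σ⌋₊ with hκ
  have hκlt : ∀ x ∈ B, κ x < 2 ^ n + 1 := fun x hx => by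
    have h1 := (hπ n x).dist_le hq0.le htpos (hB hx)
    have h2 : s x / σ ≤ ((2 ^ n : ℕ) : ℝ) := by
      rw [div_le_iff₀ hσpos, hσ]
      push_cast
      rw [mul_one_div, mul_comm, div_mul_cancel_right₀ (by positivity)]
      exact h1
    exact Nat.lt_succ_of_le (Nat.floor_le_of_le h2)
  have hs_le : ∀ x, s x ≤ (κ x + 1) * σ := fun x => by
    rw [← div_le_iff₀ hσpos]
    exact (Nat.lt_floor_add_one _).le
  have hle_s : ∀ x, κ x * σ ≤ s x := fun x => by
    rw [← le_div_iff₀ hσpos]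
    exact Nat.floor_le (by positivity)
  set d := Metric.diam (F '' B) with hd
  have hd0 : 0 ≤ d := Metric.diam_nonneg
  -- within a class, the interpolants have small `K`-radius
  have hclass : ∀ k : ℕ, ∃ ψ : E → ℕ, (∀ x, ψ x < 2 ^ 2 ^ (n + 1)) ∧
      ∀ x ∈ B, ∀ y ∈ B, κ x = k → κ y = k → ψ (π n x) = ψ (π n y) →
        dist (F (π n x)) (F (π n y)) ≤ (d + 2 * (k + 1) * σ) / 4 + 1 / (N * t) := by
    intro k
    set G := π n '' {x ∈ B | κ x = k} with hG
    rcases G.eq_empty_or_nonempty with hGe | ⟨u, hu⟩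
    · refine ⟨fun _ => 0, fun _ => by positivity, fun x hx y hy hxk _ _ => ?_⟩
      have : π n x ∈ G := ⟨x, ⟨hx, hxk⟩, rfl⟩
      rw [hGe] at this
      exact this.elim
    set δ := d + 2 * (k + 1) * σ with hδ
    have hδpos : 0 < δ := by positivity
    have hV : 0 < t * δ := by positivity
    set R := min 2 (2 * lam * (t * δ) ^ (1 / q)) with hR
    have hRpos : 0 < R := by positivity
    obtain ⟨x₀, ⟨hx₀, hx₀k⟩, rfl⟩ := hu
    have hdist : ∀ x ∈ B, κ x = k → dist (F (π n x)) (F (π n x₀)) ≤ δ := fun x hx hxk => by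
      have e1 := hs_le x
      have e2 := hs_le x₀
      rw [hxk] at e1
      rw [hx₀k] at e2
      have e3 := Metric.dist_le_diam_of_mem (h.isBounded_image hB) (Set.mem_image_of_mem F hx)
        (Set.mem_image_of_mem F hx₀)
      have e4 := dist_triangle4 (F (π n x)) (F x) (F x₀) (F (π n x₀))
      rw [dist_comm (F (π n x)) (F x)] at e4
      simp only [hs] at e1 e2
      linarith
    have hgauge : ∀ g ∈ G, gauge K (g - π n x₀) ≤ R := by
      rintro _ ⟨x, ⟨hx, hxk⟩, rfl⟩
      refine le_min (h.gauge_sub_le_two (hπ n x).mem (hπ n x₀).mem) ?_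
      have e1 := h.gauge_sub_rpow_le hlam0 hconv htpos.le (hπ n x) (hπ n x₀)
      rw [← Real.rpow_le_rpow_iff (gauge_nonneg _) (by positivity) hq0,
        Real.mul_rpow (by positivity) (by positivity), ← Real.rpow_mul hV.le,
        one_div_mul_cancel hq0.ne', Real.rpow_one]
      refine e1.trans ?_
      have := hdist x hx hxk
      gcongr
    obtain ⟨ψ, hψ, hψd⟩ := h.exists_label_of_gauge_le (lt_of_lt_of_le (by linarith) hNΛ) hm hRpos
      (hπ n x₀).mem G hgauge n
    refine ⟨ψ, hψ, fun x hx y hy hxk hyk hxy => ?_⟩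
    refine (hψd _ ⟨x, ⟨hx, hxk⟩, rfl⟩ _ ⟨y, ⟨hy, hyk⟩, rfl⟩ hxy).trans ?_
    have hyoung := radius_add_le_of_young hq hqp hqq hlam hApos hc hN hNΛ hV hcA
    rw [← mul_le_mul_iff_of_pos_left htpos]
    calc t * (16 ^ p * A / √2 ^ n * (R + √Λ * R ^ p))
        = c * (16 ^ p * A * (R + √Λ * R ^ p)) := by rw [ht]; field_simp
      _ ≤ t * δ / 4 + 1 / N := hyoung
      _ = t * (δ / 4 + 1 / (N * t)) := by
          have : N ≠ 0 := by positivity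
          field_simp
  choose Ψ hΨlt hΨ using hclass
  refine ⟨fun x => if x ∈ B then κ x * 2 ^ 2 ^ (n + 1) + Ψ (κ x) (π n x) else 0, fun x => ?_,
    fun x hx y hy z hz hyx hzx => ?_⟩
  · by_cases hx : x ∈ B
    · simp only [hx, if_true]
      refine lt_of_lt_of_le ?_ (two_pow_add_one_mul_le n)
      calc κ x * 2 ^ 2 ^ (n + 1) + Ψ (κ x) (π n x) < (κ x + 1) * 2 ^ 2 ^ (n + 1) := by
            have := hΨlt (κ x) (π n x)
            rw [add_one_mul]; omega
        _ ≤ _ := Nat.mul_le_mul_right _ (hκlt x hx)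
    · simp [hx]
  · simp only [hx, hy, hz, if_true] at hyx hzx
    have hdec : ∀ {a b : E}, κ a * 2 ^ 2 ^ (n + 1) + Ψ (κ a) (π n a)
        = κ b * 2 ^ 2 ^ (n + 1) + Ψ (κ b) (π n b) → κ a = κ b := fun {a b} hab => by
      have e : ∀ a, (κ a * 2 ^ 2 ^ (n + 1) + Ψ (κ a) (π n a)) / 2 ^ 2 ^ (n + 1) = κ a := fun a => by
        rw [mul_comm, Nat.mul_add_div (by positivity), Nat.div_eq_of_lt (hΨlt _ _), add_zero]
      rw [← e a, hab, e b]
    have hκy := hdec hyx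
    have hκz := hdec hzx
    rw [hκy] at hyx
    rw [hκz] at hzx
    have hyz : Ψ (κ x) (π n y) = Ψ (κ x) (π n z) := by omega
    have e1 := hΨ (κ x) y hy z hz hκy hκz hyz
    have e2 := dist_triangle4 (F y) (F (π n y)) (F (π n z)) (F z)
    rw [dist_comm (F (π n z)) (F z)] at e2
    have e3 := hs_le y
    have e4 := hs_le z
    rw [hκy] at e3
    rw [hκz] at e4
    have e5 := hle_s x
    have e6 : 5 / (2 ^ n * t) = 5 * σ := by rw [hσ]; ring
    rw [e6]
    simp only [hs] at e3 e4 e5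
    linarith [dist_nonneg (x := F x) (y := F (π n x))]

/-- Refining a partition step by step: `lab n x` is the label of the cell of `x` at level `n`. -/
lemma exists_labels {α : Type*} (k : ℕ → ℕ) (hk : ∀ n, 0 < k n) (S : Set α)
    (Q : ℕ → Set α → α → α → α → Prop)
    (hQ : ∀ n, ∀ B ⊆ S, ∃ ψ : α → ℕ, (∀ x, ψ x < k n) ∧
      ∀ x ∈ B, ∀ y ∈ B, ∀ z ∈ B, ψ y = ψ x → ψ z = ψ x → Q n B x y z) :
    ∃ lab : ℕ → α → ℕ, (∀ x, lab 0 x = 0) ∧ (∀ n x, lab n x < ∏ i ∈ Finset.range n, k i) ∧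
      (∀ n x y, lab (n + 1) x = lab (n + 1) y → lab n x = lab n y) ∧
      ∀ n, ∀ x ∈ S, ∀ y ∈ S, ∀ z ∈ S, lab (n + 1) y = lab (n + 1) x →
        lab (n + 1) z = lab (n + 1) x → Q n {y ∈ S | lab n y = lab n x} x y z := by
  choose ψ hψ hψQ using fun n (i : ℕ) (l : α → ℕ) =>
    hQ n {y ∈ S | l y = i} (Set.sep_subset _ _)
  let lab : ℕ → α → ℕ := fun n => Nat.rec (fun _ => 0)
    (fun n l x => l x * k n + ψ n (l x) l x) n
  have hsucc : ∀ n x, lab (n + 1) x = lab n x * k n + ψ n (lab n x) (lab n) x := fun _ _ => rfl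
  have hdiv : ∀ n x, lab (n + 1) x / k n = lab n x := fun n x => by
    rw [hsucc, mul_comm, Nat.mul_add_div (hk n), Nat.div_eq_of_lt (hψ _ _ _ _), add_zero]
  have hnest : ∀ n x y, lab (n + 1) x = lab (n + 1) y → lab n x = lab n y := fun n x y hxy => by
    rw [← hdiv n x, hxy, hdiv n y]
  have heq : ∀ n x y, lab (n + 1) y = lab (n + 1) x →
      ψ n (lab n x) (lab n) y = ψ n (lab n x) (lab n) x := fun n x y hxy => by
    have h1 := hnest n y x hxy
    rw [hsucc, hsucc, h1] at hxy
    omega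
  refine ⟨lab, fun x => rfl, fun n => ?_, hnest, fun n x hx y hy z hz hyx hzx => ?_⟩
  · induction n with
    | zero => intro x; simp [lab]
    | succ n ih =>
      intro x
      rw [Finset.prod_range_succ, hsucc]
      calc lab n x * k n + ψ n (lab n x) (lab n) x < (lab n x + 1) * k n := by
            have := hψ n (lab n x) (lab n) x
            rw [add_one_mul]; omega
        _ ≤ _ := Nat.mul_le_mul_right _ (ih x)
  · exact hψQ n (lab n x) (lab n) x ⟨hx, rfl⟩ y ⟨hy, hnest n y x hyx⟩ z ⟨hz, hnest n z x hzx⟩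
      (heq n x y hyx) (heq n x z hzx)

lemma prod_two_pow_le (n : ℕ) : ∏ i ∈ Finset.range n, 2 ^ 2 ^ (i + 2) ≤ 2 ^ 2 ^ (n + 2) := by
  induction n with
  | zero => norm_num
  | succ n ih =>
    rw [Finset.prod_range_succ]
    calc _ ≤ 2 ^ 2 ^ (n + 2) * 2 ^ 2 ^ (n + 2) := Nat.mul_le_mul_right _ ih
      _ = 2 ^ 2 ^ (n + 1 + 2) := by rw [← pow_add]; congr 1; ring

/-- Solving the recursion `w (n + 1) ≤ w n / 2 + e n`. -/
lemma sum_le_of_contraction {w e : ℕ → ℝ} (hw : ∀ n, 0 ≤ w n)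
    (hstep : ∀ n, w (n + 1) ≤ w n / 2 + e n) (N : ℕ) :
    ∑ n ∈ Finset.range (N + 1), w n ≤ 2 * w 0 + 2 * ∑ n ∈ Finset.range N, e n := by
  have h1 : ∑ n ∈ Finset.range N, w (n + 1)
      ≤ (∑ n ∈ Finset.range N, w n) / 2 + ∑ n ∈ Finset.range N, e n := by
    rw [Finset.sum_div, ← Finset.sum_add_distrib]
    exact Finset.sum_le_sum fun n _ => hstep n
  have h2 := Finset.sum_range_succ' w N
  have h3 := Finset.sum_range_succ w N
  have h4 := hw N
  linarith

end Partition

/-! ### Nested partitions -/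

section Partition

variable {E : Type*} [NormedAddCommGroup E] [InnerProductSpace ℝ E] {m : ℕ}
  {K : Set E} {X : Fin m → E} {p D H M : ℝ}

lemma IsPowerProcess.dist_zero_le (h : IsPowerProcess K X p D H M) {x : E} (hx : x ∈ K) :
    dist (powerMap X p x) (powerMap X p 0) ≤ D * H * M := by
  have hD := h.radius_pos
  have hH := h.bound_pos
  have hM := h.weight_pos
  refine le_of_sq_le_sq ?_ (by positivity)
  rw [dist_powerMap_sq]
  calc _ ≤ ∑ j, (D * H) ^ 2 * |inner ℝ (X j) x| ^ (2 * (p - 1)) := by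
        refine Finset.sum_le_sum fun j _ => ?_
        have h1 : |inner ℝ (X j) x| ≤ D * H := by
          refine (abs_real_inner_le_norm _ _).trans ?_
          rw [mul_comm]
          exact mul_le_mul (h.norm_le x hx) (h.norm_vec_le j) (norm_nonneg _) hD.le
        have h2 : signedPow p (inner ℝ (X j) 0) = 0 := by simp [signedPow]
        have h3 : |inner ℝ (X j) x| ^ (2 * (p - 1)) = (|inner ℝ (X j) x| ^ (p - 1)) ^ 2 := by
          rw [← Real.rpow_mul_natCast (abs_nonneg _), mul_comm (2 : ℝ), Nat.cast_ofNat]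
        rw [h2, sub_zero, signedPow, mul_pow, h3, ← sq_abs (inner ℝ (X j) x)]
        gcongr
    _ ≤ (D * H) ^ 2 * M ^ 2 := by
        rw [← Finset.mul_sum]
        exact mul_le_mul_of_nonneg_left (h.sum_le x hx) (by positivity)
    _ = _ := by ring

/-- The nested partitions on which the chaining argument runs. -/
lemma IsPowerProcess.exists_partitions [FiniteDimensional ℝ E] (h : IsPowerProcess K X p D H M)
    {q q' lam Λ c : ℝ} {N : ℕ} (hq : 2 ≤ q) (hqp : q ≤ p) (hqq : q.HolderConjugate q')
    (hlam : 1 ≤ lam) (hconv : HasConvexityPowerType K q lam) (hc : 0 < c) (hN : 1 ≤ N)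
    (hNΛ : (N : ℝ) ≤ Λ) (hm : 8 * (m : ℝ) ≤ Real.exp (2 * Λ))
    (hcA : c * (256 ^ p * lam ^ p * (D * H * M) * Λ ^ (1 / q')) ≤ 1) (hA : D * H * M ≤ 1 / c) :
    ∃ lab : ℕ → E → ℕ, (∀ x, lab 0 x = 0) ∧ (∀ n x, lab n x < 2 ^ 2 ^ (n + 2)) ∧
      (∀ n x y, lab (n + 1) x = lab (n + 1) y → lab n x = lab n y) ∧
      ∀ x ∈ K, ∑ n ∈ Finset.range (N + 1),
        √2 ^ n * Metric.diam (powerMap X p '' {y ∈ K | lab n y = lab n x}) ≤ 96 / c := by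
  have hq0 : 0 < q := by linarith
  have hN' : (1 : ℝ) ≤ N := by exact_mod_cast hN
  choose π hπ using fun (n : ℕ) (x : E) => h.exists_isInterpolant hq0.le (c * √2 ^ n) x
  obtain ⟨lab, hlab0, hlab, hnest, hdiam⟩ := exists_labels (fun n => 2 ^ 2 ^ (n + 2))
    (fun _ => by positivity) K _ fun n B hB =>
      h.exists_label_diam_le hq hqp hqq hlam hconv hc hN' hNΛ hm hcA hπ n hB
  refine ⟨lab, hlab0, fun n x => (hlab n x).trans_le (prod_two_pow_le n), hnest, fun x hx => ?_⟩
  set F := powerMap X p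
  set cell : ℕ → Set E := fun n => {y ∈ K | lab n y = lab n x} with hcell
  set s : ℕ → ℝ := fun n => dist (F x) (F (π n x)) with hs
  have hsqrt : √2 ≤ 2 := Real.sqrt_le_iff.2 ⟨by norm_num, by norm_num⟩
  have hstep : ∀ n, √2 ^ (n + 1) * Metric.diam (F '' cell (n + 1))
      ≤ √2 ^ n * Metric.diam (F '' cell n) / 2
        + 2 * (3 * (√2 ^ n * s n) + 5 / c * (1 / 2) ^ n + 1 / (N * c)) := by
    intro n
    have hd : Metric.diam (F '' cell (n + 1)) ≤ Metric.diam (F '' cell n) / 4 + 3 * s n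
        + 5 / (2 ^ n * (c * √2 ^ n)) + 1 / (N * (c * √2 ^ n)) := by
      refine Metric.diam_le_of_forall_dist_le ?_ ?_
      · have := Metric.diam_nonneg (s := F '' cell n)
        positivity
      · rintro _ ⟨y, ⟨hy, hyx⟩, rfl⟩ _ ⟨z, ⟨hz, hzx⟩, rfl⟩
        exact hdiam n x hx y hy z hz hyx hzx
    have hnn : 0 ≤ √2 ^ n * (Metric.diam (F '' cell n) / 4 + 3 * s n
        + 5 / (2 ^ n * (c * √2 ^ n)) + 1 / (N * (c * √2 ^ n))) := by
      have := Metric.diam_nonneg (s := F '' cell n)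
      positivity
    calc √2 ^ (n + 1) * Metric.diam (F '' cell (n + 1))
        ≤ √2 * (√2 ^ n * (Metric.diam (F '' cell n) / 4 + 3 * s n
          + 5 / (2 ^ n * (c * √2 ^ n)) + 1 / (N * (c * √2 ^ n)))) := by
          rw [pow_succ, mul_comm (√2 ^ n), mul_assoc]
          gcongr
      _ ≤ 2 * (√2 ^ n * (Metric.diam (F '' cell n) / 4 + 3 * s n
          + 5 / (2 ^ n * (c * √2 ^ n)) + 1 / (N * (c * √2 ^ n)))) :=
          mul_le_mul_of_nonneg_right hsqrt hnn
      _ = _ := by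
          have : (N : ℝ) ≠ 0 := by positivity
          rw [one_div_pow]
          field_simp
          ring
  have hsum := sum_le_of_contraction (w := fun n => √2 ^ n * Metric.diam (F '' cell n))
    (fun n => mul_nonneg (by positivity) Metric.diam_nonneg) hstep N
  have hw0 : √2 ^ 0 * Metric.diam (F '' cell 0) ≤ 2 / c := by
    rw [pow_zero, one_mul]
    refine Metric.diam_le_of_forall_dist_le (by positivity) ?_
    rintro _ ⟨y, ⟨hy, -⟩, rfl⟩ _ ⟨z, ⟨hz, -⟩, rfl⟩
    have h1 := dist_triangle_right (F y) (F z) (F 0)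
    have h2 := h.dist_zero_le hy
    have h3 := h.dist_zero_le hz
    have h4 : 2 / c = 1 / c + 1 / c := by ring
    rw [h4]
    exact h1.trans (add_le_add (h2.trans hA) (h3.trans hA))
  have he : ∑ n ∈ Finset.range N, 2 * (3 * (√2 ^ n * s n) + 5 / c * (1 / 2) ^ n + 1 / (N * c))
      ≤ 46 / c := by
    rw [← Finset.mul_sum, Finset.sum_add_distrib, Finset.sum_add_distrib, ← Finset.mul_sum,
      ← Finset.mul_sum, Finset.sum_const, Finset.card_range, nsmul_eq_mul]
    have h1 : ∑ n ∈ Finset.range N, √2 ^ n * s n ≤ 4 / c := by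
      refine le_trans ?_ (IsPowerProcess.sum_dist_isInterpolant_le hq0.le hc hπ hx N)
      rw [Finset.sum_range_succ]
      exact le_add_of_nonneg_right (by positivity)
    have h2 : 5 / c * ∑ n ∈ Finset.range N, (1 / 2 : ℝ) ^ n ≤ 5 / c * 2 :=
      mul_le_mul_of_nonneg_left (sum_geometric_two_le N) (by positivity)
    have h3 : (N : ℝ) * (1 / (N * c)) = 1 / c := by
      have : (N : ℝ) ≠ 0 := by positivity
      field_simp
    rw [h3]
    have e1 : 46 / c = 2 * (3 * (4 / c) + 5 / c * 2 + 1 / c) := by ring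
    rw [e1]
    gcongr
  have e2 : 96 / c = 2 * (2 / c) + 2 * (46 / c) := by ring
  rw [e2]
  linarith

end Partition

/-! ### Bernoulli sums -/

section Signs

variable {Ω : Type*} [MeasurableSpace Ω] {μ : Measure Ω} [IsProbabilityMeasure μ] {m : ℕ}
  {ε : Fin m → Ω → ℝ}

lemma IsBernoulliSigns.ae_eq_or (hε : IsBernoulliSigns μ ε) (j : Fin m) :
    ∀ᵐ ω ∂μ, ε j ω = 1 ∨ ε j ω = -1 := by
  have hm1 : MeasurableSet {ω | ε j ω = 1} := hε.measurable j (measurableSet_singleton 1)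
  have hm2 : MeasurableSet {ω | ε j ω = -1} := hε.measurable j (measurableSet_singleton (-1))
  have hdisj : Disjoint {ω | ε j ω = 1} {ω | ε j ω = -1} := by
    rw [Set.disjoint_left]
    intro ω h1 h2
    have h1' : ε j ω = 1 := h1
    have h2' : ε j ω = -1 := h2
    linarith
  have hU : μ ({ω | ε j ω = 1} ∪ {ω | ε j ω = -1}) = 1 := by
    rw [measure_union hdisj hm2, hε.prob_one, hε.prob_neg_one, ENNReal.add_halves]
  have := (prob_compl_eq_zero_iff (hm1.union hm2)).2 hU
  exact this

lemma IsBernoulliSigns.integral_eq_zero (hε : IsBernoulliSigns μ ε) (j : Fin m) :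
    ∫ ω, ε j ω ∂μ = 0 := by
  have hm1 : MeasurableSet {ω | ε j ω = 1} := hε.measurable j (measurableSet_singleton 1)
  have h1 : ε j =ᵐ[μ] fun ω => 2 * {ω | ε j ω = 1}.indicator 1 ω - 1 := by
    filter_upwards [hε.ae_eq_or j] with ω hω
    rcases hω with h | h
    · have hmem : ω ∈ {ω | ε j ω = 1} := h
      rw [Set.indicator_of_mem hmem, h]; norm_num
    · have hmem : ω ∉ {ω | ε j ω = 1} := fun h' => by
        have h'' : ε j ω = 1 := h'
        linarith
      rw [Set.indicator_of_notMem hmem, h]; norm_num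
  rw [integral_congr_ae h1, integral_sub _ (integrable_const _), integral_const_mul,
    integral_indicator_one hm1]
  · simp [Measure.real, hε.prob_one]
  · exact ((integrable_const (1 : ℝ)).indicator hm1).const_mul 2

/-- Bernoulli sums are subgaussian. -/
lemma IsBernoulliSigns.hasSubgaussianMGF (hε : IsBernoulliSigns μ ε) {a : Fin m → ℝ}
    (ha : ∑ l, a l ^ 2 ≤ 1) (θ : ℝ) :
    Integrable (fun ω => Real.exp (θ * ∑ l, ε l ω * a l)) μ ∧
      ∫ ω, Real.exp (θ * ∑ l, ε l ω * a l) ∂μ ≤ Real.exp (θ ^ 2 / 2) := by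
  have h1 : ∀ l, HasSubgaussianMGF (fun ω => a l * ε l ω) (‖a l‖₊ ^ 2) μ := by
    intro l
    have h : HasSubgaussianMGF (fun ω => a l * ε l ω)
        (.mk (a l ^ 2) (sq_nonneg _) * (‖(1 : ℝ) - -1‖₊ / 2) ^ 2) μ :=
      (hasSubgaussianMGF_of_mem_Icc_of_integral_eq_zero (a := -1) (b := 1)
      (hε.measurable l).aemeasurable (by
        filter_upwards [hε.ae_eq_or l] with ω hω
        rcases hω with h | h <;> rw [h] <;> norm_num) (hε.integral_eq_zero l)).const_mul (a l)
    have hone : (‖(1 : ℝ) - -1‖₊ / 2) ^ 2 = 1 := by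
      refine NNReal.eq ?_
      push_cast
      norm_num
    have hsq : (.mk (a l ^ 2) (sq_nonneg _) : NNReal) = ‖a l‖₊ ^ 2 := by
      refine NNReal.eq ?_
      push_cast
      simp
    rwa [hone, mul_one, hsq] at h
  have hind : iIndepFun (fun l ω => a l * ε l ω) μ :=
    hε.indep.comp (fun l x => a l * x) fun l => measurable_const_mul _
  have h2 := HasSubgaussianMGF.sum_of_iIndepFun hind (s := Finset.univ) fun l _ => h1 l
  have hfun : ∀ ω, ∑ l, a l * ε l ω = ∑ l, ε l ω * a l := fun ω =>
    Finset.sum_congr rfl fun l _ => mul_comm _ _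
  simp only [hfun] at h2
  refine ⟨h2.integrable_exp_mul θ, (h2.mgf_le θ).trans (Real.exp_le_exp.2 ?_)⟩
  push_cast
  have h3 := mul_le_mul_of_nonneg_right ha (sq_nonneg θ)
  simp only [Real.norm_eq_abs, sq_abs]
  linarith

/-- The number of links at level `n` times the contribution of each of them, for the threshold
`6 * √2 ^ n`, decays geometrically. -/
lemma card_mul_exp_le (n : ℕ) :
    ((2 ^ 2 ^ (n + 2) : ℕ) : ℝ) * ((2 ^ 2 ^ (n + 3) : ℕ) : ℝ)
      * (Real.exp (-(6 * √2 ^ n) ^ 2) * (2 * Real.exp ((6 * √2 ^ n) ^ 2 / 2)))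
      ≤ 2 * (1 / 2) ^ n := by
  have hb2 : (√2 ^ n) ^ 2 = ((2 ^ n : ℕ) : ℝ) := by
    rw [← pow_mul, mul_comm, pow_mul, Real.sq_sqrt (by norm_num)]; push_cast; rfl
  have h2e : (2 : ℝ) ≤ Real.exp 1 := by linarith [Real.add_one_le_exp 1]
  have hcard : ((2 ^ 2 ^ (n + 2) : ℕ) : ℝ) * ((2 ^ 2 ^ (n + 3) : ℕ) : ℝ)
      ≤ Real.exp (12 * ((2 ^ n : ℕ) : ℝ)) := by
    push_cast
    rw [← pow_add]
    calc (2 : ℝ) ^ (2 ^ (n + 2) + 2 ^ (n + 3)) ≤ Real.exp 1 ^ (2 ^ (n + 2) + 2 ^ (n + 3)) :=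
          pow_le_pow_left₀ (by norm_num) h2e _
      _ = Real.exp (12 * 2 ^ n) := by
          rw [← Real.exp_nat_mul]; congr 1; push_cast; ring
  have hexp : Real.exp (-(6 * √2 ^ n) ^ 2) * (2 * Real.exp ((6 * √2 ^ n) ^ 2 / 2))
      = 2 * Real.exp (-(18 * ((2 ^ n : ℕ) : ℝ))) := by
    rw [mul_left_comm, ← Real.exp_add, mul_pow, hb2]
    congr 2; ring
  have hsmall : Real.exp (-(6 * ((2 ^ n : ℕ) : ℝ))) ≤ (1 / 2) ^ n := by
    have h1 : (n : ℝ) ≤ 6 * ((2 ^ n : ℕ) : ℝ) := by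
      have : (n : ℝ) ≤ ((2 ^ n : ℕ) : ℝ) := by exact_mod_cast Nat.lt_two_pow_self.le
      linarith [Nat.cast_nonneg (α := ℝ) n]
    calc Real.exp (-(6 * ((2 ^ n : ℕ) : ℝ))) ≤ Real.exp (n * (-1)) :=
          Real.exp_le_exp.2 (by linarith)
      _ = Real.exp (-1) ^ n := Real.exp_nat_mul _ _
      _ ≤ (1 / 2) ^ n := by
          refine pow_le_pow_left₀ (Real.exp_pos _).le ?_ n
          rw [Real.exp_neg, one_div]
          exact inv_anti₀ (by norm_num) h2e
  rw [hexp]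
  calc _ ≤ Real.exp (12 * ((2 ^ n : ℕ) : ℝ)) * (2 * Real.exp (-(18 * ((2 ^ n : ℕ) : ℝ)))) := by
        gcongr
    _ = 2 * Real.exp (-(6 * ((2 ^ n : ℕ) : ℝ))) := by
        rw [mul_left_comm, ← Real.exp_add]; congr 2; ring
    _ ≤ _ := by linarith

/-- Simultaneous control of the Bernoulli sums attached to the links of a chaining tree: the level
`n` deviations, of which there are at most `2 ^ 2 ^ (n + 2) * 2 ^ 2 ^ (n + 3)`, are all of order
`√2 ^ n`. -/
lemma IsBernoulliSigns.exists_bound (hε : IsBernoulliSigns μ ε)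
    (a : ℕ → ℕ → ℕ → Fin m → ℝ) (ha : ∀ n i j, ∑ l, a n i j l ^ 2 ≤ 1) (N : ℕ) :
    ∃ W : Ω → ℝ, Integrable W μ ∧ ∫ ω, W ω ∂μ ≤ 10 ∧ (∀ ω, 0 ≤ W ω) ∧
      ∀ ω, ∀ n < N, ∀ i < 2 ^ 2 ^ (n + 2), ∀ j < 2 ^ 2 ^ (n + 3),
        |∑ l, ε l ω * a n i j l| ≤ √2 ^ n * W ω := by
  set θ : ℕ → ℝ := fun n => 6 * √2 ^ n with hθ
  have hb1 : ∀ n, 1 ≤ √2 ^ n := fun n => one_le_pow₀ (Real.one_le_sqrt.2 (by norm_num))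
  set U : ℕ → ℕ → ℕ → Ω → ℝ := fun n i j ω => ∑ l, ε l ω * a n i j l with hU
  set e : ℕ → ℕ → ℕ → Ω → ℝ := fun n i j ω => Real.exp (-θ n ^ 2) *
    (Real.exp (θ n * U n i j ω) + Real.exp (-θ n * U n i j ω)) with he
  have he0 : ∀ n i j ω, 0 ≤ e n i j ω := fun n i j ω => by positivity
  have hei : ∀ n i j, Integrable (e n i j) μ := fun n i j =>
    ((hε.hasSubgaussianMGF (ha n i j) (θ n)).1.add
      (hε.hasSubgaussianMGF (ha n i j) (-θ n)).1).const_mul _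
  have heI : ∀ n i j, ∫ ω, e n i j ω ∂μ ≤ Real.exp (-θ n ^ 2) * (2 * Real.exp (θ n ^ 2 / 2)) := by
    intro n i j
    rw [integral_const_mul, integral_add (hε.hasSubgaussianMGF (ha n i j) (θ n)).1
      (hε.hasSubgaussianMGF (ha n i j) (-θ n)).1]
    refine mul_le_mul_of_nonneg_left ?_ (Real.exp_pos _).le
    have h1 := (hε.hasSubgaussianMGF (ha n i j) (θ n)).2
    have h2 := (hε.hasSubgaussianMGF (ha n i j) (-θ n)).2
    rw [neg_sq] at h2
    linarith
  set S : Ω → ℝ := fun ω => ∑ n ∈ Finset.range N, ∑ i ∈ Finset.range (2 ^ 2 ^ (n + 2)),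
    ∑ j ∈ Finset.range (2 ^ 2 ^ (n + 3)), e n i j ω with hS
  have hSi : Integrable S μ := integrable_finsetSum _ fun n _ => integrable_finsetSum _ fun i _ =>
    integrable_finsetSum _ fun j _ => hei n i j
  have hSI : ∫ ω, S ω ∂μ ≤ 4 := by
    calc ∫ ω, S ω ∂μ = ∑ n ∈ Finset.range N, ∑ i ∈ Finset.range (2 ^ 2 ^ (n + 2)),
          ∑ j ∈ Finset.range (2 ^ 2 ^ (n + 3)), ∫ ω, e n i j ω ∂μ := by
          rw [integral_finsetSum _ fun n _ => integrable_finsetSum _ fun i _ =>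
            integrable_finsetSum _ fun j _ => hei n i j]
          refine Finset.sum_congr rfl fun n _ => ?_
          rw [integral_finsetSum _ fun i _ => integrable_finsetSum _ fun j _ => hei n i j]
          refine Finset.sum_congr rfl fun i _ => ?_
          rw [integral_finsetSum _ fun j _ => hei n i j]
      _ ≤ ∑ n ∈ Finset.range N, 2 * (1 / 2 : ℝ) ^ n := by
          refine Finset.sum_le_sum fun n _ => le_trans ?_ (card_mul_exp_le n)
          refine (Finset.sum_le_card_nsmul _ _ _ fun i _ =>
            Finset.sum_le_card_nsmul _ _ _ fun j _ => heI n i j).trans (le_of_eq ?_)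
          rw [Finset.card_range, Finset.card_range, nsmul_eq_mul, nsmul_eq_mul, mul_assoc]
      _ ≤ 4 := by
          rw [← Finset.mul_sum]
          linarith [sum_geometric_two_le N]
  have hS0 : ∀ ω, 0 ≤ S ω := fun ω => Finset.sum_nonneg fun n _ => Finset.sum_nonneg fun i _ =>
    Finset.sum_nonneg fun j _ => he0 n i j ω
  refine ⟨fun ω => 6 + S ω, (integrable_const _).add hSi, ?_, fun ω => by linarith [hS0 ω],
    fun ω n hn i hi j hj => ?_⟩
  · rw [integral_add (integrable_const _) hSi]
    simp only [integral_const, probReal_univ, one_smul]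
    linarith
  · have hle : e n i j ω ≤ S ω := by
      refine le_trans ?_ (Finset.single_le_sum (f := fun n => ∑ i ∈ Finset.range (2 ^ 2 ^ (n + 2)),
        ∑ j ∈ Finset.range (2 ^ 2 ^ (n + 3)), e n i j ω)
        (fun n _ => Finset.sum_nonneg fun i _ => Finset.sum_nonneg fun j _ => he0 n i j ω)
        (Finset.mem_range.2 hn))
      refine le_trans ?_ (Finset.single_le_sum (f := fun i =>
        ∑ j ∈ Finset.range (2 ^ 2 ^ (n + 3)), e n i j ω)
        (fun i _ => Finset.sum_nonneg fun j _ => he0 n i j ω) (Finset.mem_range.2 hi))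
      exact Finset.single_le_sum (f := fun j => e n i j ω) (fun j _ => he0 n i j ω)
        (Finset.mem_range.2 hj)
    -- `|U| - θ ≤ exp (θ (|U| - θ))`, since `θ ≥ 1`
    have hU1 : |U n i j ω| ≤ θ n + e n i j ω := by
      have hθ1 : 1 ≤ θ n := by simp only [hθ]; linarith [hb1 n]
      have h1 : Real.exp (-θ n ^ 2) * Real.exp (θ n * |U n i j ω|) ≤ e n i j ω := by
        refine mul_le_mul_of_nonneg_left ?_ (Real.exp_pos _).le
        have p1 := Real.exp_pos (θ n * U n i j ω)
        have p2 := Real.exp_pos (-θ n * U n i j ω)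
        rcases abs_choice (U n i j ω) with h | h <;> rw [h]
        · linarith
        · rw [mul_neg, ← neg_mul]; linarith
      rw [← Real.exp_add] at h1
      have h2 := Real.add_one_le_exp (-θ n ^ 2 + θ n * |U n i j ω|)
      by_contra! hcon
      have h3 : |U n i j ω| - θ n ≤ θ n * (|U n i j ω| - θ n) :=
        le_mul_of_one_le_left (by linarith [he0 n i j ω]) hθ1
      nlinarith
    have h3 : e n i j ω ≤ √2 ^ n * S ω := by
      nlinarith [hb1 n, hS0 ω]
    calc |U n i j ω| ≤ θ n + e n i j ω := hU1
      _ ≤ √2 ^ n * (6 + S ω) := by simp only [hθ]; linarith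

end Signs

/-! ### Chaining -/

section Chaining

variable {E : Type*} [NormedAddCommGroup E] [InnerProductSpace ℝ E] {m : ℕ}
  {K : Set E} {X : Fin m → E} {p D H M : ℝ}

lemma IsPowerProcess.sum_sq_rpow_sub_le (h : IsPowerProcess K X p D H M) (x y : E) :
    ∑ l, (|inner ℝ (X l) x| ^ p - |inner ℝ (X l) y| ^ p) ^ 2
      ≤ dist (powerMap X p x) (powerMap X p y) ^ 2 := by
  rw [dist_powerMap_sq]
  exact Finset.sum_le_sum fun l _ => sq_le_sq.2 (abs_abs_rpow_sub_le h.one_lt _ _)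

/-- Chaining along nested partitions: each point is joined to the origin through the
representatives of its cells, the representative at level `n + 1` lying in the cell of level `n`,
so that the links are bounded by the diameters of the cells. -/
lemma IsPowerProcess.exists_dominating (h : IsPowerProcess K X p D H M)
    {Ω : Type*} [MeasurableSpace Ω] {μ : Measure Ω} [IsProbabilityMeasure μ] {ε : Fin m → Ω → ℝ}
    (hε : IsBernoulliSigns μ ε) {N : ℕ} (hmN : m ≤ 2 ^ N) {S : ℝ} {lab : ℕ → E → ℕ}
    (hlab0 : ∀ x, lab 0 x = 0) (hlab : ∀ n x, lab n x < 2 ^ 2 ^ (n + 2))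
    (hnest : ∀ n x y, lab (n + 1) x = lab (n + 1) y → lab n x = lab n y)
    (hS : ∀ x ∈ K, ∑ n ∈ Finset.range (N + 1),
        √2 ^ n * Metric.diam (powerMap X p '' {y ∈ K | lab n y = lab n x}) ≤ S) :
    ∃ W : Ω → ℝ, Integrable W μ ∧ ∫ ω, W ω ∂μ ≤ 11 * S ∧
      ∀ᵐ ω ∂μ, ∀ y ∈ K, |∑ l, ε l ω * |inner ℝ (X l) y| ^ p| ≤ W ω := by
  classical
  set F := powerMap X p with hF
  set v : E → Fin m → ℝ := fun x l => |inner ℝ (X l) x| ^ p with hv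
  -- representatives of the cells; the single cell of level `0` is represented by the origin
  have hrep : ∀ n i, ∃ r : E, ∀ y ∈ K, lab n y = i → r ∈ K ∧ lab n r = i ∧ (n = 0 → r = 0) := by
    intro n i
    rcases Nat.eq_zero_or_pos n with rfl | hn
    · exact ⟨0, fun y _ hyi => ⟨h.zero_mem, by rw [← hyi, hlab0, hlab0], fun _ => rfl⟩⟩
    · by_cases hex : ∃ y ∈ K, lab n y = i
      · obtain ⟨y, hy, hyi⟩ := hex
        exact ⟨y, fun _ _ _ => ⟨hy, hyi, fun h0 => absurd h0 hn.ne'⟩⟩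
      · exact ⟨0, fun y hy hyi => absurd ⟨y, hy, hyi⟩ hex⟩
  choose r hr using hrep
  set a : ℕ → ℕ → ℕ → Fin m → ℝ := fun n i j l =>
    (v (r n i) l - v (r (n + 1) j) l) / dist (F (r n i)) (F (r (n + 1) j)) with ha
  have ha1 : ∀ n i j, ∑ l, a n i j l ^ 2 ≤ 1 := fun n i j => by
    simp only [ha, div_pow]
    rw [← Finset.sum_div]
    exact div_le_one_of_le₀ (h.sum_sq_rpow_sub_le _ _) (by positivity)
  have hlink : ∀ n i j l, v (r n i) l - v (r (n + 1) j) l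
      = dist (F (r n i)) (F (r (n + 1) j)) * a n i j l := fun n i j l => by
    by_cases h0 : dist (F (r n i)) (F (r (n + 1) j)) = 0
    · have h1 := h.sum_sq_rpow_sub_le (r n i) (r (n + 1) j)
      rw [← hF, h0] at h1
      have h2 := Finset.single_le_sum (f := fun l => (v (r n i) l - v (r (n + 1) j) l) ^ 2)
        (fun l _ => sq_nonneg _) (Finset.mem_univ l)
      simp only [hv] at h2 ⊢
      rw [h0, zero_mul]
      exact pow_eq_zero_iff (two_ne_zero) |>.1 (le_antisymm (by linarith) (sq_nonneg _))
    · simp only [ha]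
      field_simp
  obtain ⟨W, hWi, hWI, hW0, hW⟩ := hε.exists_bound a ha1 N
  have hS0 : 0 ≤ S := (Finset.sum_nonneg fun n _ =>
    mul_nonneg (by positivity) Metric.diam_nonneg).trans (hS 0 h.zero_mem)
  refine ⟨fun ω => (W ω + 1) * S, (hWi.add (integrable_const 1)).mul_const S, ?_, ?_⟩
  · rw [integral_mul_const, integral_add hWi (integrable_const 1)]
    refine mul_le_mul_of_nonneg_right ?_ hS0
    simp only [integral_const, probReal_univ, one_smul]
    linarith
  filter_upwards [ae_all_iff.2 hε.ae_eq_or] with ω hω y hy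
  set Z : E → ℝ := fun x => ∑ l, ε l ω * v x l with hZ
  set t : ℕ → E := fun n => r n (lab n y) with ht
  set d : ℕ → ℝ := fun n => Metric.diam (F '' {z ∈ K | lab n z = lab n y}) with hd
  have htK : ∀ n, t n ∈ K ∧ lab n (t n) = lab n y := fun n =>
    ⟨(hr n _ y hy rfl).1, (hr n _ y hy rfl).2.1⟩
  have hcell : ∀ n x z, x ∈ K → z ∈ K → lab n x = lab n y → lab n z = lab n y →
      dist (F x) (F z) ≤ d n := fun n x z hx hz hxy hzy =>
    Metric.dist_le_diam_of_mem (h.isBounded_image (Set.sep_subset _ _))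
      (Set.mem_image_of_mem F ⟨hx, hxy⟩) (Set.mem_image_of_mem F ⟨hz, hzy⟩)
  have hZ0 : Z (t 0) = 0 := by
    have h0 : t 0 = 0 := (hr 0 _ y hy rfl).2.2 rfl
    simp only [hZ, h0, hv, inner_zero_right, abs_zero]
    rw [Real.zero_rpow (by linarith [h.two_le])]
    simp
  have hZsub : ∀ x z, Z x - Z z = ∑ l, ε l ω * (v x l - v z l) := fun x z => by
    simp only [hZ, mul_sub, Finset.sum_sub_distrib]
  have hstep : ∀ n < N, |Z (t n) - Z (t (n + 1))| ≤ W ω * (√2 ^ n * d n) := fun n hn => by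
    have h1 : Z (t n) - Z (t (n + 1)) = dist (F (t n)) (F (t (n + 1)))
        * ∑ l, ε l ω * a n (lab n y) (lab (n + 1) y) l := by
      rw [hZsub, Finset.mul_sum]
      refine Finset.sum_congr rfl fun l _ => ?_
      rw [hlink, mul_left_comm]
    rw [h1, abs_mul, abs_of_nonneg dist_nonneg]
    have h2 := hW ω n hn _ (hlab n y) _ (hlab (n + 1) y)
    have h3 := hcell n (t n) (t (n + 1)) (htK n).1 (htK (n + 1)).1 (htK n).2
      (hnest n _ _ (htK (n + 1)).2)
    calc _ ≤ d n * (√2 ^ n * W ω) := mul_le_mul h3 h2 (abs_nonneg _) Metric.diam_nonneg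
      _ = _ := by ring
  -- beyond level `N` the Cauchy--Schwarz inequality suffices
  have hlast : |Z (t N) - Z y| ≤ √2 ^ N * d N := by
    have h1 : dist (F (t N)) (F y) ≤ d N := hcell N _ _ (htK N).1 hy (htK N).2 rfl
    have h2 : (Z (t N) - Z y) ^ 2 ≤ (√2 ^ N * d N) ^ 2 := by
      rw [hZsub]
      refine (Finset.sum_mul_sq_le_sq_mul_sq _ _ _).trans ?_
      rw [mul_pow]
      refine mul_le_mul ?_ ?_ (Finset.sum_nonneg fun _ _ => sq_nonneg _) (by positivity)
      · have h3 : ∀ l, ε l ω ^ 2 = 1 := fun l => by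
          rcases hω l with h' | h' <;> rw [h'] <;> norm_num
        simp only [h3]
        rw [Finset.sum_const, Finset.card_univ, Fintype.card_fin, nsmul_eq_mul, mul_one, ← pow_mul,
          mul_comm N, pow_mul, Real.sq_sqrt (by norm_num)]
        exact_mod_cast hmN
      · exact (h.sum_sq_rpow_sub_le _ _).trans (pow_le_pow_left₀ dist_nonneg h1 2)
    exact abs_le_of_sq_le_sq h2 (mul_nonneg (by positivity) Metric.diam_nonneg)
  have htel : Z y = -(∑ n ∈ Finset.range N, (Z (t n) - Z (t (n + 1)))) - (Z (t N) - Z y) := by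
    rw [Finset.sum_range_sub', hZ0]; ring
  have hsum := hS y hy
  rw [Finset.sum_range_succ] at hsum
  have hA0 : 0 ≤ ∑ n ∈ Finset.range N, √2 ^ n * d n := Finset.sum_nonneg fun n _ =>
    mul_nonneg (by positivity) Metric.diam_nonneg
  have hB0 : 0 ≤ √2 ^ N * d N := mul_nonneg (by positivity) Metric.diam_nonneg
  calc |Z y| ≤ |∑ n ∈ Finset.range N, (Z (t n) - Z (t (n + 1)))| + |Z (t N) - Z y| := by
        have h1 := abs_sub (-∑ n ∈ Finset.range N, (Z (t n) - Z (t (n + 1)))) (Z (t N) - Z y)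
        rwa [← htel, abs_neg] at h1
    _ ≤ ∑ n ∈ Finset.range N, W ω * (√2 ^ n * d n) + √2 ^ N * d N := by
        refine add_le_add ((Finset.abs_sum_le_sum_abs _ _).trans ?_) hlast
        exact Finset.sum_le_sum fun n hn => hstep n (Finset.mem_range.1 hn)
    _ ≤ (W ω + 1) * S := by
        rw [← Finset.mul_sum, add_one_mul]
        refine add_le_add (mul_le_mul_of_nonneg_left ?_ (hW0 ω)) ?_ <;> linarith

/-- The supremum is a lower semicontinuous function of the signs, hence measurable, although it
runs over an uncountable set. -/
lemma measurable_iSup_abs_sum {Ω : Type*} [MeasurableSpace Ω] {ε : Fin m → Ω → ℝ}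
    (hε : ∀ j, Measurable (ε j)) (hK : IsCompact K) (hp : 0 ≤ p) :
    Measurable fun ω => ⨆ y : K, |∑ j, ε j ω * |inner ℝ (X j) (y : E)| ^ p| := by
  have hG : LowerSemicontinuous fun b : Fin m → ℝ =>
      ⨆ y : K, |∑ j, b j * |inner ℝ (X j) (y : E)| ^ p| := by
    refine lowerSemicontinuous_ciSup (fun b => ?_) fun y => Continuous.lowerSemicontinuous ?_
    · have hc : Continuous fun y : E => |∑ j, b j * |inner ℝ (X j) y| ^ p| := by
        refine continuous_abs.comp (continuous_finsetSum _ fun j _ => continuous_const.mul ?_)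
        exact (continuous_abs.comp (by fun_prop)).rpow_const fun _ => Or.inr hp
      refine (hK.bddAbove_image hc.continuousOn).mono ?_
      rintro _ ⟨y, rfl⟩
      exact ⟨y, y.2, rfl⟩
    · exact continuous_abs.comp (continuous_finsetSum _ fun j _ =>
        (continuous_apply j).mul continuous_const)
  exact hG.measurable.comp (measurable_pi_lambda _ hε)

/-- The case of a nondegenerate process, with explicit constants. -/
lemma IsPowerProcess.integral_iSup_le [FiniteDimensional ℝ E] (h : IsPowerProcess K X p D H M)
    {Ω : Type*} [MeasurableSpace Ω] {μ : Measure Ω} [IsProbabilityMeasure μ] {ε : Fin m → Ω → ℝ}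
    (hε : IsBernoulliSigns μ ε) {q q' lam : ℝ} (hq : 2 ≤ q) (hqp : q ≤ p)
    (hqq : q.HolderConjugate q') (hlam : 1 ≤ lam) (hconv : HasConvexityPowerType K q lam)
    (hm : 2 ≤ m) :
    Integrable (fun ω => ⨆ y : K, |∑ j, ε j ω * |inner ℝ (X j) (y : E)| ^ p|) μ ∧
      ∫ ω, (⨆ y : K, |∑ j, ε j ω * |inner ℝ (X j) (y : E)| ^ p|) ∂μ
        ≤ 16384 ^ p * lam ^ p * Real.log m ^ (1 / q') * (D * H * M) := by
  have hA : 0 < D * H * M := mul_pos (mul_pos h.radius_pos h.bound_pos) h.weight_pos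
  have hq'0 : 0 < q' := hqq.symm.pos
  have hp2 := h.two_le
  have hm2 : (2 : ℝ) ≤ m := by exact_mod_cast hm
  have hm0 : (0 : ℝ) < m := by linarith
  have hlog2 : Real.log 2 ≤ Real.log m := Real.log_le_log (by norm_num) hm2
  have hl2 := Real.log_two_gt_d9
  set Λ := 3 * Real.log m with hΛ
  set N := Nat.clog 2 m with hN
  have hN1 : 1 ≤ N := Nat.clog_pos (by norm_num) hm
  have hNΛ : (N : ℝ) ≤ Λ := by
    have h1 : 2 ^ (N - 1) < m := Nat.pow_pred_clog_lt_self (by norm_num) hm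
    have h2 : ((N : ℝ) - 1) * Real.log 2 ≤ Real.log m := by
      have h3 : (((N - 1 : ℕ) : ℝ)) * Real.log 2 ≤ Real.log m := by
        rw [← Real.log_pow]
        exact Real.log_le_log (by positivity) (by exact_mod_cast h1.le)
      rwa [Nat.cast_sub hN1, Nat.cast_one] at h3
    have h4 : (0 : ℝ) ≤ N := Nat.cast_nonneg N
    nlinarith
  have hexp : 8 * (m : ℝ) ≤ Real.exp (2 * Λ) := by
    have h1 : Real.exp (2 * Λ) = (m : ℝ) ^ 6 := by
      rw [hΛ, show 2 * (3 * Real.log m) = ((6 : ℕ) : ℝ) * Real.log m by push_cast; ring,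
        Real.exp_nat_mul, Real.exp_log hm0]
    have h2 : (2 : ℝ) ^ 5 ≤ (m : ℝ) ^ 5 := pow_le_pow_left₀ (by norm_num) hm2 5
    rw [h1, pow_succ]
    nlinarith
  have hΛ1 : 1 ≤ Λ := le_trans (by exact_mod_cast hN1) hNΛ
  set c : ℝ := (256 ^ p * lam ^ p * (D * H * M) * Λ ^ (1 / q'))⁻¹ with hc
  have hcpos : 0 < c := by positivity
  have hcA : c * (256 ^ p * lam ^ p * (D * H * M) * Λ ^ (1 / q')) ≤ 1 :=
    (inv_mul_cancel₀ (by positivity)).le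
  have hAc : D * H * M ≤ 1 / c := by
    rw [hc, one_div, inv_inv]
    have e1 : (1 : ℝ) ≤ 256 ^ p := Real.one_le_rpow (by norm_num) (by linarith)
    have e2 : 1 ≤ lam ^ p := Real.one_le_rpow hlam (by linarith)
    have e3 : 1 ≤ Λ ^ (1 / q') := Real.one_le_rpow hΛ1 (by positivity)
    calc D * H * M = 1 * 1 * (D * H * M) * 1 := by ring
      _ ≤ _ := by gcongr
  obtain ⟨lab, hlab0, hlab, hnest, hS⟩ := h.exists_partitions hq hqp hqq hlam hconv hcpos hN1 hNΛ
    hexp hcA hAc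
  obtain ⟨W, hWi, hWI, hW⟩ := h.exists_dominating hε (Nat.le_pow_clog (by norm_num) m) hlab0 hlab
    hnest hS
  have hne : Nonempty K := ⟨⟨0, h.zero_mem⟩⟩
  have hsup0 : ∀ ω, 0 ≤ ⨆ y : K, |∑ j, ε j ω * |inner ℝ (X j) (y : E)| ^ p| := fun ω =>
    Real.iSup_nonneg fun _ => abs_nonneg _
  have hle : ∀ᵐ ω ∂μ, (⨆ y : K, |∑ j, ε j ω * |inner ℝ (X j) (y : E)| ^ p|) ≤ W ω := by
    filter_upwards [hW] with ω hω
    exact ciSup_le fun y => hω y y.2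
  have hint : Integrable (fun ω => ⨆ y : K, |∑ j, ε j ω * |inner ℝ (X j) (y : E)| ^ p|) μ := by
    refine hWi.mono' (measurable_iSup_abs_sum hε.measurable h.isCompact
      (by linarith)).aestronglyMeasurable ?_
    filter_upwards [hle] with ω hω
    rwa [Real.norm_of_nonneg (hsup0 ω)]
  refine ⟨hint, (integral_mono_ae hint hWi hle).trans (hWI.trans ?_)⟩
  have hΛlog : Λ ^ (1 / q') ≤ 3 * Real.log m ^ (1 / q') := by
    rw [hΛ, Real.mul_rpow (by norm_num) (by linarith)]
    refine mul_le_mul_of_nonneg_right ?_ (Real.rpow_nonneg (by linarith) _)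
    have : 1 / q' ≤ 1 := by
      have := hqq.inv_add_inv_eq_one
      have := inv_pos.2 hqq.pos
      rw [one_div]; linarith
    simpa using Real.rpow_le_rpow_of_exponent_le (show (1 : ℝ) ≤ 3 by norm_num) this
  have hconst : (3168 : ℝ) * 256 ^ p ≤ 16384 ^ p := by
    have h1 : (16384 : ℝ) ^ p = 64 ^ p * 256 ^ p := by
      rw [← Real.mul_rpow (by norm_num) (by norm_num)]; norm_num
    have h2 : (3168 : ℝ) ≤ 64 ^ p := by
      calc (3168 : ℝ) ≤ 64 ^ (2 : ℝ) := by norm_num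
        _ ≤ 64 ^ p := Real.rpow_le_rpow_of_exponent_le (by norm_num) hp2
    rw [h1]
    gcongr
  calc 11 * (96 / c) = 1056 * 256 ^ p * lam ^ p * (D * H * M) * Λ ^ (1 / q') := by
        rw [hc, div_inv_eq_mul]; ring
    _ ≤ 1056 * 256 ^ p * lam ^ p * (D * H * M) * (3 * Real.log m ^ (1 / q')) := by gcongr
    _ = (3168 * 256 ^ p) * lam ^ p * Real.log m ^ (1 / q') * (D * H * M) := by ring
    _ ≤ _ := by
        have : 0 ≤ Real.log m ^ (1 / q') := Real.rpow_nonneg (by linarith) _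
        gcongr

end Chaining

/-! ### Symmetric convex bodies and the final bound -/

lemma Convex.mem_nhds_zero_of_symmetric {E : Type*} [NormedAddCommGroup E] [NormedSpace ℝ E]
    {K : Set E} (hK : Convex ℝ K) (hsymm : ∀ x ∈ K, -x ∈ K) (hint : (interior K).Nonempty) :
    K ∈ nhds (0 : E) := by
  obtain ⟨x, hx⟩ := hint
  have h := hK.combo_interior_self_mem_interior hx (hsymm x (interior_subset hx))
    (a := 1 / 2) (b := 1 / 2) (by norm_num) (by norm_num) (by norm_num)
  rw [smul_neg, add_neg_cancel] at h
  exact mem_interior_iff_mem_nhds.1 h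

/-- The convexity constant is at least `1`, as the choice `y = -x` shows. -/
lemma HasConvexityPowerType.one_le {E : Type*} [NormedAddCommGroup E] [NormedSpace ℝ E]
    {K : Set E} {q lam : ℝ} (h : HasConvexityPowerType K q lam) (hq : 0 < q) (hlam : 0 < lam)
    (hsymm : ∀ x ∈ K, -x ∈ K) (hnhds : K ∈ nhds (0 : E)) (hb : Bornology.IsBounded K) {x : E}
    (hx : x ≠ 0) : 1 ≤ lam := by
  have hg : 0 < gauge K x := (gauge_pos (absorbent_nhds_zero hnhds)
    (NormedSpace.isVonNBounded_of_isBounded ℝ hb)).2 hx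
  have h1 := h x (-x)
  have h2 : (2 : ℝ)⁻¹ • (x - -x) = x := by
    rw [sub_neg_eq_add, ← two_smul ℝ x, smul_smul]; norm_num
  rw [h2, add_neg_cancel, smul_zero, gauge_zero, Real.zero_rpow hq.ne', zero_add,
    gauge_neg hsymm] at h1
  have hgq := Real.rpow_pos_of_pos hg q
  have h3 : lam ^ (-q) ≤ 1 := by
    by_contra! hcon
    nlinarith
  by_contra! hcon
  have h4 := Real.one_lt_rpow_of_pos_of_lt_one_of_neg hlam hcon (neg_neg_of_pos hq)
  linarith

theorem mainTheorem2 :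
    ∃ C : ℝ, 0 < C ∧
      ∀ (E : Type*) [NormedAddCommGroup E] [InnerProductSpace ℝ E] [FiniteDimensional ℝ E]
        (K : ConvexBody E) (D q q' lam p : ℝ) (m : ℕ) (X : Fin m → E)
        (Ω : Type*) [MeasurableSpace Ω] (μ : Measure Ω) [IsProbabilityMeasure μ]
        (ε : Fin m → Ω → ℝ),
        (interior (K : Set E)).Nonempty →
        (∀ x ∈ K, -x ∈ K) →
        HasRadius (K : Set E) D →
        2 ≤ q →
        q.HolderConjugate q' →
        0 < lam →
        HasConvexityPowerType (K : Set E) q lam →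
        q ≤ p →
        2 ≤ m →
        IsBernoulliSigns μ ε →
        Integrable (fun ω => ⨆ y : K, |∑ j, ε j ω * |inner ℝ (X j) (y : E)| ^ p|) μ ∧
        ∫ ω, (⨆ y : K, |∑ j, ε j ω * |inner ℝ (X j) (y : E)| ^ p|) ∂μ
          ≤ C ^ p * lam ^ p * Real.log m ^ (1 / q') * D * (⨆ j, ‖X j‖) *
              ⨆ y : K, Real.sqrt (∑ j, |inner ℝ (X j) (y : E)| ^ (2 * (p - 1))) := by
  refine ⟨16384, by norm_num, ?_⟩
  intro E _ _ _ K D q q' lam p m X Ω _ μ _ ε hint hsymm hD hq hqq hlam hconv hqp hm hε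
  have hp2 : 2 ≤ p := hq.trans hqp
  have hnhds : (K : Set E) ∈ nhds 0 := K.convex.mem_nhds_zero_of_symmetric hsymm hint
  have h0 : (0 : E) ∈ (K : Set E) := mem_of_mem_nhds hnhds
  have hnorm : ∀ y ∈ (K : Set E), ‖y‖ ≤ D := fun y hy => by simpa using hD.1 hy
  have hD0 : 0 ≤ D := (norm_nonneg _).trans (hnorm 0 h0)
  have hlog0 : 0 ≤ Real.log m := Real.log_nonneg (by exact_mod_cast (by omega : 1 ≤ m))
  have hM_le : ∀ y ∈ (K : Set E), √(∑ j, |inner ℝ (X j) y| ^ (2 * (p - 1)))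
      ≤ ⨆ y : K, √(∑ j, |inner ℝ (X j) (y : E)| ^ (2 * (p - 1))) := by
    have hc : Continuous fun y : E => √(∑ j, |inner ℝ (X j) y| ^ (2 * (p - 1))) := by
      refine Real.continuous_sqrt.comp (continuous_finsetSum _ fun j _ => ?_)
      exact (continuous_abs.comp (by fun_prop)).rpow_const fun _ => Or.inr (by linarith)
    have hbdd : BddAbove (Set.range fun y : K =>
        √(∑ j, |inner ℝ (X j) (y : E)| ^ (2 * (p - 1)))) := by
      refine (K.isCompact.bddAbove_image hc.continuousOn).mono ?_
      rintro _ ⟨y, rfl⟩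
      exact ⟨y, y.2, rfl⟩
    exact fun y hy => le_ciSup hbdd ⟨y, hy⟩
  have hH_le : ∀ j, ‖X j‖ ≤ ⨆ j, ‖X j‖ := fun j =>
    le_ciSup (f := fun j => ‖X j‖) (Set.finite_range _).bddAbove j
  set H := ⨆ j, ‖X j‖
  set M := ⨆ y : K, √(∑ j, |inner ℝ (X j) (y : E)| ^ (2 * (p - 1)))
  have hH0 : 0 ≤ H := (norm_nonneg _).trans (hH_le ⟨0, by omega⟩)
  have hM0 : 0 ≤ M := (Real.sqrt_nonneg _).trans (hM_le 0 h0)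
  by_cases hdeg : ∀ j, ∀ y ∈ (K : Set E), (inner ℝ (X j) y : ℝ) = 0
  · have hzero : (fun ω => ⨆ y : K, |∑ j, ε j ω * |inner ℝ (X j) (y : E)| ^ p|) = fun _ => 0 := by
      funext ω
      have : ∀ y : K, |∑ j, ε j ω * |inner ℝ (X j) (y : E)| ^ p| = 0 := fun y => by
        rw [Finset.sum_eq_zero fun j _ => ?_, abs_zero]
        rw [hdeg j y y.2, abs_zero, Real.zero_rpow (by linarith), mul_zero]
      simp [this]
    simp only [hzero, integral_zero]
    exact ⟨integrable_zero _ _ _, by positivity⟩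
  · push Not at hdeg
    obtain ⟨j, y, hy, hjy⟩ := hdeg
    have hyne : y ≠ 0 := fun h => hjy (by rw [h, inner_zero_right])
    have hXne : X j ≠ 0 := fun h => hjy (by rw [h, inner_zero_left])
    have hproc : IsPowerProcess (K : Set E) X p D H M :=
      { convex := K.convex
        isCompact := K.isCompact
        neg_mem := hsymm
        mem_nhds := hnhds
        two_le := hp2
        radius_pos := (norm_pos_iff.2 hyne).trans_le (hnorm y hy)
        norm_le := hnorm
        bound_pos := (norm_pos_iff.2 hXne).trans_le (hH_le j)
        norm_vec_le := hH_le
        weight_pos := by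
          refine lt_of_lt_of_le (Real.sqrt_pos.2 ?_) (hM_le y hy)
          refine Finset.sum_pos' (fun _ _ => by positivity) ⟨j, Finset.mem_univ j, ?_⟩
          exact Real.rpow_pos_of_pos (abs_pos.2 hjy) _
        sum_le := fun y hy => (Real.sqrt_le_left hM0).1 (hM_le y hy) }
    have hlam1 := hconv.one_le (by linarith) hlam hsymm hnhds K.isCompact.isBounded hyne
    have hfin := hproc.integral_iSup_le hε hq hqp hqq hlam1 hconv hm
    refine ⟨hfin.1, hfin.2.trans (le_of_eq ?_)⟩
    ring
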